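/- Let $k$ be a field, let $H$ be a Hopf algebra over $k$ with bijective antipode, and let $R$ be a Hopf algebra in the braided monoidal category ${}^H_H\mathcal{YD}$ of left-left Yetter–Drinfeld modules over $H$. Assume that $R$ is connected, i.e. that the coradical of the coalgebra $R$ (the sum of its simple subcoalgebras) is $k1$. A *right coideal subalgebra* of $R$ is a Yetter–Drinfeld submodule $B\subseteq R$ that is a (unital) subalgebra with $\Delta(B)\subseteq B\otimes R$; put $B^+=B\cap\ker\varepsilon$. A *quotient left $R$-module coalgebra* of $R$ is a quotient $\pi\colon R\to T=R/J$, where $J\subseteq R$ is a Yetter–Drinfeld submodule that is both a left ideal and a coideal. Then $R$ is a left $T$-comodule via $r\mapsto \pi(r^{(1)})\otimes r^{(2)}$ and a right $T$-comodule via $r\mapsto r^{(1)}\otimes\pi(r^{(2)})$, and ${}^{\mathrm{co}\,T}R=\{r\in R:\pi(r^{(1)})\otimes r^{(2)}=\pi(1)\otimes r\}$. A left (right) $T$-comodule is *cofree* if it is isomorphic, as a comodule, to $T\otimes V$ (to $V\otimes T$) for some vector space $V$, with coaction induced by $\Delta_T$. Then: (a) $R$ is free as a left module and as a right module over every right coideal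 subalgebra. (b) $R$ is cofree as a left comodule and as a right comodule over every quotient left $R$-module coalgebra. (c) $B\mapsto R/RB^+$ and $T\mapsto {}^{\mathrm{co}\,T}R$ are well-defined, mutually inverse bijections between the set of right coideal subalgebras $B$ of $R$ and the set of quotient left $R$-module coalgebras $T$ of $R$. (d) If $B$ and $T$ correspond to each other under this bijection, there is a linear isomorphism $T\otimes B\to R$ that is left $T$-colinear (for the coaction $\Delta_T\otimes\mathrm{id}_B$ on $T\otimes B$) and right $B$-linear (for the action $(t\otimes b)\cdot b'=t\otimes bb'$). -/

import Mathlib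

open scoped TensorProduct

noncomputable section

namespace BraidedHopf

/-! ### Coradical and connectedness -/

section Coradical

variable (k : Type*) {C : Type*} [Field k] [AddCommGroup C] [Module k C] [Coalgebra k C]

/-- `D` is a subcoalgebra: `Δ(D) ⊆ D ⊗ D`. -/
def IsSubcoalgebra (D : Submodule k C) : Prop :=
  ∀ x ∈ D, (Coalgebra.comul (R := k) x) ∈
    LinearMap.range (TensorProduct.map D.subtype D.subtype)

/-- A simple subcoalgebra: nonzero, with no proper nonzero subcoalgebra. -/
def IsSimpleSubcoalgebra (D : Submodule k C) : Prop :=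
  IsSubcoalgebra k D ∧ D ≠ ⊥ ∧
    ∀ E : Submodule k C, E ≤ D → IsSubcoalgebra k E → E = ⊥ ∨ E = D

variable (C) in
/-- The coradical: the sum of all simple subcoalgebras. -/
def coradical : Submodule k C :=
  sSup {D : Submodule k C | IsSimpleSubcoalgebra k D}

end Coradical

/-- A coalgebra with a unit element `1` is connected when its coradical is the line `k 1`. -/
def IsConnected (k R : Type*) [Field k] [Ring R] [Algebra k R] [Coalgebra k R] : Prop :=
  coradical k R = Submodule.span k {(1 : R)}

/-! ### Left-left Yetter–Drinfeld modules -/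

section Action

variable (k H : Type*) [Field k] [Ring H] [HopfAlgebra k H]
variable (V : Type*) [AddCommGroup V] [Module k V] [Module H V] [IsScalarTower k H V]
variable (W : Type*) [AddCommGroup W] [Module k W] [Module H W] [IsScalarTower k H W]

/-- The action map `H ⊗ V → V`, `h ⊗ v ↦ h • v`. -/
def actMap : H ⊗[k] V →ₗ[k] V :=
  TensorProduct.lift (Algebra.lsmul k k V : H →ₐ[k] Module.End k V).toLinearMap

/-- The diagonal action map `H ⊗ (V ⊗ W) → V ⊗ W`, `h ⊗ (v ⊗ w) ↦ h₁ • v ⊗ h₂ • w`. -/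
def diagActMap : H ⊗[k] (V ⊗[k] W) →ₗ[k] V ⊗[k] W :=
  TensorProduct.map (actMap k H V) (actMap k H W) ∘ₗ
    (TensorProduct.tensorTensorTensorComm k H H V W).toLinearMap ∘ₗ
    (Coalgebra.comul (R := k) (A := H)).rTensor (V ⊗[k] W)

end Action

/-- A left-left Yetter–Drinfeld module over `H`: a left `H`-module `V` with a left `H`-coaction
`v ↦ v₍₋₁₎ ⊗ v₍₀₎` such that
`h₁ v₍₋₁₎ ⊗ h₂ • v₍₀₎ = (h₁ • v)₍₋₁₎ h₂ ⊗ (h₁ • v)₍₀₎`. -/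
class YetterDrinfeldModule (k H V : Type*) [Field k] [Ring H] [HopfAlgebra k H]
    [AddCommGroup V] [Module k V] [Module H V] [IsScalarTower k H V] where
  /-- the left coaction -/
  coact : V →ₗ[k] H ⊗[k] V
  coact_coassoc :
    (TensorProduct.assoc k H H V).toLinearMap ∘ₗ
        (Coalgebra.comul (R := k) (A := H)).rTensor V ∘ₗ coact =
      coact.lTensor H ∘ₗ coact
  coact_counit :
    (Coalgebra.counit (R := k) (A := H)).rTensor V ∘ₗ coact = TensorProduct.mk k k V 1
  compat :
    TensorProduct.map (LinearMap.mul' k H) (actMap k H V) ∘ₗ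
        (TensorProduct.tensorTensorTensorComm k H H H V).toLinearMap ∘ₗ
        TensorProduct.map (Coalgebra.comul (R := k) (A := H)) coact =
      (LinearMap.mul' k H).rTensor V ∘ₗ
        (TensorProduct.rightComm k H V H).toLinearMap ∘ₗ
        (coact ∘ₗ actMap k H V).rTensor H ∘ₗ
        (TensorProduct.rightComm k H H V).toLinearMap ∘ₗ
        (Coalgebra.comul (R := k) (A := H)).rTensor V

section YD

variable (k H : Type*) [Field k] [Ring H] [HopfAlgebra k H]
variable (V : Type*) [AddCommGroup V] [Module k V] [Module H V] [IsScalarTower k H V]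
  [YetterDrinfeldModule k H V]
variable (W : Type*) [AddCommGroup W] [Module k W] [Module H W] [IsScalarTower k H W]
  [YetterDrinfeldModule k H W]

/-- The left `H`-coaction `v ↦ v₍₋₁₎ ⊗ v₍₀₎` of a Yetter–Drinfeld module. -/
def coact : V →ₗ[k] H ⊗[k] V := YetterDrinfeldModule.coact

/-- The codiagonal coaction `v ⊗ w ↦ v₍₋₁₎ w₍₋₁₎ ⊗ (v₍₀₎ ⊗ w₍₀₎)` on `V ⊗ W`. -/
def codiagCoact : V ⊗[k] W →ₗ[k] H ⊗[k] (V ⊗[k] W) :=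
  (LinearMap.mul' k H).rTensor (V ⊗[k] W) ∘ₗ
    (TensorProduct.tensorTensorTensorComm k H V H W).toLinearMap ∘ₗ
    TensorProduct.map (coact k H V) (coact k H W)

/-- The braiding `V ⊗ W → W ⊗ V`, `v ⊗ w ↦ v₍₋₁₎ • w ⊗ v₍₀₎`, of Yetter–Drinfeld modules. -/
def braiding : V ⊗[k] W →ₗ[k] W ⊗[k] V :=
  (actMap k H W).rTensor V ∘ₗ
    (TensorProduct.rightComm k H V W).toLinearMap ∘ₗ
    (coact k H V).rTensor W

variable {k V} in
/-- A Yetter–Drinfeld submodule: stable under the action and under the coaction. -/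
structure IsYDSubmodule (U : Submodule k V) : Prop where
  smul_mem : ∀ (h : H), ∀ v ∈ U, h • v ∈ U
  coact_mem : ∀ v ∈ U, coact k H V v ∈ LinearMap.range (U.subtype.lTensor H)

end YD

/-! ### Hopf algebras in the category of Yetter–Drinfeld modules -/

/-- The multiplication of the braided tensor product algebra `R ⊗ R`:
`(r ⊗ s) ⊗ (r' ⊗ s') ↦ r (s₍₋₁₎ • r') ⊗ s₍₀₎ s'`. -/
def braidedMul (k H R : Type*) [Field k] [Ring H] [HopfAlgebra k H]
    [Ring R] [Algebra k R] [Module H R] [IsScalarTower k H R] [YetterDrinfeldModule k H R] :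
    (R ⊗[k] R) ⊗[k] (R ⊗[k] R) →ₗ[k] R ⊗[k] R :=
  TensorProduct.map (LinearMap.mul' k R) (LinearMap.mul' k R) ∘ₗ
    (TensorProduct.assoc k R R (R ⊗[k] R)).symm.toLinearMap ∘ₗ
    ((TensorProduct.assoc k R R R).toLinearMap ∘ₗ
      (braiding k H R R).rTensor R ∘ₗ
      (TensorProduct.assoc k R R R).symm.toLinearMap).lTensor R ∘ₗ
    (TensorProduct.assoc k R R (R ⊗[k] R)).toLinearMap

/-- A Hopf algebra `R` in the braided category of left-left Yetter–Drinfeld modules over `H`: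
an algebra and a coalgebra whose structure maps are `H`-linear and `H`-colinear, such that the
counit and the comultiplication `R → R ⊗ R` (braided tensor product) are algebra maps, with an
antipode in the category. -/
class YDHopfAlgebra (k H R : Type*) [Field k] [Ring H] [HopfAlgebra k H]
    [Ring R] [Algebra k R] [Coalgebra k R] [Module H R] [IsScalarTower k H R]
    [YetterDrinfeldModule k H R] where
  -- unit and multiplication are morphisms
  smul_one : ∀ h : H, h • (1 : R) = Coalgebra.counit (R := k) h • (1 : R)
  coact_one : coact k H R 1 = 1 ⊗ₜ[k] 1
  act_mul : actMap k H R ∘ₗ (LinearMap.mul' k R).lTensor H =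
    LinearMap.mul' k R ∘ₗ diagActMap k H R R
  coact_mul : coact k H R ∘ₗ LinearMap.mul' k R =
    (LinearMap.mul' k R).lTensor H ∘ₗ codiagCoact k H R R
  -- counit and comultiplication are morphisms
  counit_smul : ∀ (h : H) (r : R),
    Coalgebra.counit (R := k) (h • r) = Coalgebra.counit (R := k) h * Coalgebra.counit (R := k) r
  counit_coact : ∀ r : R,
    (Coalgebra.counit (R := k) (A := R)).lTensor H (coact k H R r) =
      1 ⊗ₜ[k] Coalgebra.counit (R := k) r
  comul_act : Coalgebra.comul (R := k) (A := R) ∘ₗ actMap k H R =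
    diagActMap k H R R ∘ₗ (Coalgebra.comul (R := k) (A := R)).lTensor H
  comul_coact : (Coalgebra.comul (R := k) (A := R)).lTensor H ∘ₗ coact k H R =
    codiagCoact k H R R ∘ₗ Coalgebra.comul (R := k) (A := R)
  -- counit and comultiplication are algebra maps
  counit_one : Coalgebra.counit (R := k) (1 : R) = 1
  counit_mul : ∀ r s : R,
    Coalgebra.counit (R := k) (r * s) = Coalgebra.counit (R := k) r * Coalgebra.counit (R := k) s
  comul_one : Coalgebra.comul (R := k) (1 : R) = 1 ⊗ₜ[k] 1
  comul_mul : ∀ r s : R, Coalgebra.comul (R := k) (r * s) =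
    braidedMul k H R (Coalgebra.comul (R := k) r ⊗ₜ[k] Coalgebra.comul (R := k) s)
  /-- the antipode -/
  antipode : R →ₗ[k] R
  antipode_smul : ∀ (h : H) (r : R), antipode (h • r) = h • antipode r
  coact_antipode : coact k H R ∘ₗ antipode = antipode.lTensor H ∘ₗ coact k H R
  mul_antipode_rTensor_comul :
    LinearMap.mul' k R ∘ₗ antipode.rTensor R ∘ₗ Coalgebra.comul (R := k) (A := R) =
      Algebra.linearMap k R ∘ₗ Coalgebra.counit
  mul_antipode_lTensor_comul :
    LinearMap.mul' k R ∘ₗ antipode.lTensor R ∘ₗ Coalgebra.comul (R := k) (A := R) =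
      Algebra.linearMap k R ∘ₗ Coalgebra.counit

/-! ### Right coideal subalgebras and quotient left module coalgebras -/

section SubQuot

variable (k H R : Type*) [Field k] [Ring H] [HopfAlgebra k H]
  [Ring R] [Algebra k R] [Coalgebra k R] [Module H R] [IsScalarTower k H R]
  [YetterDrinfeldModule k H R]

/-- A right coideal subalgebra of `R` in the category of Yetter–Drinfeld modules: a subalgebra and
Yetter–Drinfeld submodule `B` with `Δ(B) ⊆ B ⊗ R`. -/
structure RightCoidealSubalgebra where
  /-- the underlying subalgebra -/
  alg : Subalgebra k R
  isYD : IsYDSubmodule H (Subalgebra.toSubmodule alg)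
  comul_mem : ∀ x ∈ alg, Coalgebra.comul (R := k) x ∈
    LinearMap.range ((Subalgebra.toSubmodule alg).subtype.rTensor R)

/-- A quotient left `R`-module coalgebra `T` of `R` in the category of Yetter–Drinfeld modules.
Quotient objects of `R` are identified when they are isomorphic under `R`, so that `T = R ⧸ ker`
is given by the kernel of the projection `R → T`. The action of `R`, the action and the coaction
of `H`, and the coalgebra structure descend to `R ⧸ ker` when `ker` is, respectively, a left ideal,
a Yetter–Drinfeld submodule, and a coideal. -/
structure QuotientLeftModuleCoalgebra where
  /-- the kernel of the projection, a left ideal of `R` -/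
  ker : Submodule R R
  isYD : IsYDSubmodule H (ker.restrictScalars k)
  isCoideal : (ker.restrictScalars k).IsCoideal

end SubQuot

section Operations

variable {k H R : Type*} [Field k] [Ring H] [HopfAlgebra k H]
  [Ring R] [Algebra k R] [Coalgebra k R] [Module H R] [IsScalarTower k H R]
  [YetterDrinfeldModule k H R]

/-- The left ideal `R B⁺`, where `B⁺ = {b ∈ B | ε(b) = 0}`. -/
def RightCoidealSubalgebra.leftIdeal (B : RightCoidealSubalgebra k H R) : Submodule R R :=
  Submodule.span R {b : R | b ∈ B.alg ∧ Coalgebra.counit (R := k) b = 0}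

namespace QuotientLeftModuleCoalgebra

variable (T : QuotientLeftModuleCoalgebra k H R)

instance : (T.ker.restrictScalars k).IsCoideal := T.isCoideal

/-- The quotient `T = R ⧸ ker`, with Mathlib's quotient coalgebra structure. -/
abbrev Quot : Type _ := R ⧸ T.ker.restrictScalars k

/-- The projection `π : R → T`. -/
def proj : R →ₗ[k] T.Quot := (T.ker.restrictScalars k).mkQ

/-- The left `T`-coaction `r ↦ π(r₁) ⊗ r₂` of `R`. -/
def leftCoact : R →ₗ[k] T.Quot ⊗[k] R :=
  T.proj.rTensor R ∘ₗ Coalgebra.comul (R := k) (A := R)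

/-- The right `T`-coaction `r ↦ r₁ ⊗ π(r₂)` of `R`. -/
def rightCoact : R →ₗ[k] R ⊗[k] T.Quot :=
  T.proj.lTensor R ∘ₗ Coalgebra.comul (R := k) (A := R)

/-- The left `T`-coinvariants `{r | π(r₁) ⊗ r₂ = π(1) ⊗ r}` of `R`. -/
def leftCoinvariants : Submodule k R :=
  LinearMap.eqLocus T.leftCoact (TensorProduct.mk k T.Quot R (T.proj 1))

end QuotientLeftModuleCoalgebra

end Operations

/-! ### Cofree comodules -/

/-- A left `C`-comodule is cofree if it is isomorphic to `C ⊗ V`, with coaction `Δ ⊗ id`, for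
some vector space `V`. -/
def IsLeftCofree.{u} {k C : Type*} {M : Type u} [Field k] [AddCommGroup C] [Module k C]
    [Coalgebra k C] [AddCommGroup M] [Module k M] (coaction : M →ₗ[k] C ⊗[k] M) : Prop :=
  ∃ (V : Type u) (_ : AddCommGroup V) (_ : Module k V) (e : M ≃ₗ[k] C ⊗[k] V),
    e.toLinearMap.lTensor C ∘ₗ coaction =
      (TensorProduct.assoc k C C V).toLinearMap ∘ₗ
        (Coalgebra.comul (R := k) (A := C)).rTensor V ∘ₗ e.toLinearMap

/-- A right `C`-comodule is cofree if it is isomorphic to `V ⊗ C`, with coaction `id ⊗ Δ`, for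
some vector space `V`. -/
def IsRightCofree.{u} {k C : Type*} {M : Type u} [Field k] [AddCommGroup C] [Module k C]
    [Coalgebra k C] [AddCommGroup M] [Module k M] (coaction : M →ₗ[k] M ⊗[k] C) : Prop :=
  ∃ (V : Type u) (_ : AddCommGroup V) (_ : Module k V) (e : M ≃ₗ[k] V ⊗[k] C),
    e.toLinearMap.rTensor C ∘ₗ coaction =
      (TensorProduct.assoc k V C C).symm.toLinearMap ∘ₗ
        (Coalgebra.comul (R := k) (A := C)).lTensor V ∘ₗ e.toLinearMap

end BraidedHopf

end

/-!
Freeness, cofreeness and the correspondence all come from comparing leading terms with respect to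
the coradical filtration of `R`.

*The filtration.* Let `F n` be the space on which all convolution products of `n` functionals
vanishing at `1` vanish, so that `F 0 = 0`, `F 1 = k 1`, and `r ∈ F (n + 1)` if and only if
`Δ(r) - 1 ⊗ r ∈ R ⊗ F n`, if and only if `Δ(r) - r ⊗ 1 ∈ F n ⊗ R`. Connectedness makes the
filtration exhaustive (`exists_mem_filt`): every element lies in a finite-dimensional subcoalgebra
`D`; the simple quotients of the dual algebra of `D` correspond to simple subcoalgebras, hence to
`k 1`; thus functionals vanishing at `1` are in the Jacobson radical of this algebra, which is
nilpotent. Each `F n` is a Yetter–Drinfeld submodule (`isYDSubmodule_F`).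

*Cofreeness.* Let `π : R → T` be a quotient and `q` a linear retraction of `R` onto the
`T`-coinvariants. The colinear map `r ↦ π(r₁) ⊗ q(r₂)` is injective, since its kernel is a
subcomodule without nonzero coinvariants (`leftMap_injective`). For a coinvariant `b` the element
`r b` is mapped to `π(r) ⊗ b` up to terms of lower degree in `r`, which gives surjectivity
(`leftMap_surjective`). On the other side the leading term of `Δ(r b)` is the braiding of `r ⊗ b`
(`rightMap_surjective`), and bijectivity of the antipode of `H` is what makes the braiding
invertible (`braiding_invBraiding`, `invBraiding_braiding`).

*Freeness.* For `x ∈ F (n + 1)` and `b ∈ B ∩ F (m + 1)` the leading term of `Δ(x b)` is `x ⊗ b`, and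
that of `Δ(b x)` is the braiding of `b ⊗ x`. Hence lifts to `F (n + 1)` of a basis of the image of
`F (n + 1)` in `R / (F n) B` are linearly independent over `B` modulo `(F n) B`, and all these lifts
together form a basis of `R` over `B` adapted to the filtration (`exists_filtered_basis`,
`exists_right_basis`, `exists_left_basis`).

*Correspondence.* Coordinates in an adapted basis show that the coinvariants of `R / R B⁺` are no
larger than `B` (`leftCoinvariants_quotientCoalgebra`), and provide a right `B`-linear retraction
`q : R → B` (`exists_retraction`). If `B` is the algebra of coinvariants of `T`, then both
`R → T ⊗ B` and `R → (R / R B⁺) ⊗ B` given by `q` are bijective, so that the kernel of `R → T` is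
`R B⁺` (`leftIdeal_coinvariantSubalgebra`). The inverse of the second map is the isomorphism that is
left `T`-colinear and right `B`-linear (`exists_normal_basis`).
-/

open scoped TensorProduct

noncomputable section

namespace BraidedHopf

/-! ### Subspaces of tensor products and slice maps -/

section Slices

variable {k M N P : Type*} [Field k] [AddCommGroup M] [Module k M] [AddCommGroup N] [Module k N]
  [AddCommGroup P] [Module k P]

/-- The subspace `U ⊗ V` of `M ⊗ N`, spanned by the tensors `u ⊗ v` with `u ∈ U` and `v ∈ V`. -/
def tens (U : Submodule k M) (V : Submodule k N) : Submodule k (M ⊗[k] N) :=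
  Submodule.map₂ (TensorProduct.mk k M N) U V

/-- The slice map `f ⊗ id : M ⊗ N → N` of a functional `f` on `M`. -/
def lslice (f : M →ₗ[k] k) : M ⊗[k] N →ₗ[k] N :=
  (TensorProduct.lid k N).toLinearMap ∘ₗ f.rTensor N

/-- The slice map `id ⊗ f : M ⊗ N → M` of a functional `f` on `N`. -/
def rslice (f : N →ₗ[k] k) : M ⊗[k] N →ₗ[k] M :=
  (TensorProduct.rid k M).toLinearMap ∘ₗ f.lTensor M

@[simp] lemma lslice_tmul (f : M →ₗ[k] k) (m : M) (n : N) : lslice f (m ⊗ₜ[k] n) = f m • n := by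
  simp [lslice]

@[simp] lemma rslice_tmul (f : N →ₗ[k] k) (m : M) (n : N) : rslice f (m ⊗ₜ[k] n) = f n • m := by
  simp [rslice]

lemma tmul_mem_tens {U : Submodule k M} {V : Submodule k N} {u : M} {v : N} (hu : u ∈ U)
    (hv : v ∈ V) : u ⊗ₜ[k] v ∈ tens U V :=
  Submodule.apply_mem_map₂ _ hu hv

lemma tens_mono {U U' : Submodule k M} {V V' : Submodule k N} (hU : U ≤ U') (hV : V ≤ V') :
    tens U V ≤ tens U' V' :=
  Submodule.map₂_le_map₂ hU hV

lemma tens_top_top : tens (⊤ : Submodule k M) (⊤ : Submodule k N) = ⊤ :=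
  TensorProduct.map₂_mk_top_top_eq_top _ _ _

lemma tens_induction {U : Submodule k M} {V : Submodule k N} (f : M ⊗[k] N →ₗ[k] P)
    (W : Submodule k P) (h : ∀ u ∈ U, ∀ v ∈ V, f (u ⊗ₜ v) ∈ W) {z : M ⊗[k] N}
    (hz : z ∈ tens U V) : f z ∈ W := by
  have : tens U V ≤ W.comap f := Submodule.map₂_le.2 fun u hu v hv => h u hu v hv
  exact this hz

lemma range_lTensor_subtype (V : Submodule k N) :
    LinearMap.range (V.subtype.lTensor M) = tens ⊤ V := by
  rw [LinearMap.lTensor, TensorProduct.range_map, LinearMap.range_id, Submodule.range_subtype]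
  rfl

lemma range_rTensor_subtype (U : Submodule k M) :
    LinearMap.range (U.subtype.rTensor N) = tens U ⊤ := by
  rw [LinearMap.rTensor, TensorProduct.range_map, LinearMap.range_id, Submodule.range_subtype]
  rfl

lemma range_map_subtype (U : Submodule k M) (V : Submodule k N) :
    LinearMap.range (TensorProduct.map U.subtype V.subtype) = tens U V := by
  rw [TensorProduct.range_map, Submodule.range_subtype, Submodule.range_subtype]
  rfl

lemma lslice_lTensor (f : M →ₗ[k] k) (g : N →ₗ[k] P) (z : M ⊗[k] N) :
    lslice f (g.lTensor M z) = g (lslice f z) := by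
  induction z with
  | zero => simp
  | tmul m n => simp
  | add x y hx hy => simp [hx, hy]

lemma rslice_rTensor (f : N →ₗ[k] k) (g : M →ₗ[k] P) (z : M ⊗[k] N) :
    rslice f (g.rTensor N z) = g (rslice f z) := by
  induction z with
  | zero => simp
  | tmul m n => simp
  | add x y hx hy => simp [hx, hy]

lemma lslice_rTensor (f : P →ₗ[k] k) (g : M →ₗ[k] P) (z : M ⊗[k] N) :
    lslice f (g.rTensor N z) = lslice (f ∘ₗ g) z := by
  induction z with
  | zero => simp
  | tmul m n => simp
  | add x y hx hy => simp [hx, hy]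

lemma rslice_lTensor (f : P →ₗ[k] k) (g : N →ₗ[k] P) (z : M ⊗[k] N) :
    rslice f (g.lTensor M z) = rslice (f ∘ₗ g) z := by
  induction z with
  | zero => simp
  | tmul m n => simp
  | add x y hx hy => simp [hx, hy]

lemma mem_tens_top_left {V : Submodule k N} {z : M ⊗[k] N} :
    z ∈ tens ⊤ V ↔ ∀ f : M →ₗ[k] k, lslice f z ∈ V := by
  refine ⟨fun h f => tens_induction (lslice f) V (fun u _ v hv => ?_) h, fun h => ?_⟩
  · simpa using V.smul_mem _ hv
  · classical
    let b := Module.Basis.ofVectorSpace k M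
    have := (TensorProduct.equivFinsuppOfBasisLeft (N := N) b).symm_apply_apply z
    rw [← this, TensorProduct.equivFinsuppOfBasisLeft_symm_apply]
    refine Submodule.sum_mem _ fun i _ => tmul_mem_tens trivial ?_
    rw [TensorProduct.equivFinsuppOfBasisLeft_apply]
    exact h _

lemma mem_tens_top_right {U : Submodule k M} {z : M ⊗[k] N} :
    z ∈ tens U ⊤ ↔ ∀ f : N →ₗ[k] k, rslice f z ∈ U := by
  refine ⟨fun h f => tens_induction (rslice f) U (fun u hu v _ => ?_) h, fun h => ?_⟩
  · simpa using U.smul_mem _ hu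
  · classical
    let b := Module.Basis.ofVectorSpace k N
    have := (TensorProduct.equivFinsuppOfBasisRight (M := M) b).symm_apply_apply z
    rw [← this, TensorProduct.equivFinsuppOfBasisRight_symm_apply]
    refine Submodule.sum_mem _ fun i _ => tmul_mem_tens ?_ trivial
    rw [TensorProduct.equivFinsuppOfBasisRight_apply]
    exact h _

lemma tens_top_bot : tens (⊤ : Submodule k M) (⊥ : Submodule k N) = ⊥ :=
  Submodule.map₂_bot_right _ _

lemma tens_bot_top : tens (⊥ : Submodule k M) (⊤ : Submodule k N) = ⊥ :=
  Submodule.map₂_bot_left _ _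

lemma eq_of_lslice {z w : M ⊗[k] N} (h : ∀ f : M →ₗ[k] k, lslice f z = lslice f w) : z = w := by
  rw [← sub_eq_zero, ← Submodule.mem_bot k, ← tens_top_bot, mem_tens_top_left]
  intro f
  simp [h]

lemma eq_of_rslice {z w : M ⊗[k] N} (h : ∀ f : N →ₗ[k] k, rslice f z = rslice f w) : z = w := by
  rw [← sub_eq_zero, ← Submodule.mem_bot k, ← tens_bot_top, mem_tens_top_right]
  intro f
  simp [h]

/-- `(U ⊗ N) ∩ (M ⊗ V) = U ⊗ V`. -/
lemma mem_tens_of_mem {U : Submodule k M} {V : Submodule k N} {z : M ⊗[k] N}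
    (h₁ : z ∈ tens U ⊤) (h₂ : z ∈ tens ⊤ V) : z ∈ tens U V := by
  rw [← range_rTensor_subtype] at h₁
  obtain ⟨y, rfl⟩ := h₁
  have hy : y ∈ tens (⊤ : Submodule k U) V := by
    rw [mem_tens_top_left] at h₂ ⊢
    intro f
    obtain ⟨g, rfl⟩ := LinearMap.exists_extend f
    rw [← lslice_rTensor]
    exact h₂ g
  exact tens_induction (U.subtype.rTensor N) _
    (fun u _ v hv => tmul_mem_tens u.2 hv) hy

lemma ker_lTensor (f : N →ₗ[k] P) (z : M ⊗[k] N) :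
    f.lTensor M z = 0 ↔ z ∈ tens ⊤ (LinearMap.ker f) := by
  rw [mem_tens_top_left]
  simp_rw [LinearMap.mem_ker, ← lslice_lTensor]
  exact ⟨fun h => by simp [h], fun h => eq_of_lslice fun g => by simp [h]⟩

lemma ker_rTensor (f : M →ₗ[k] P) (z : M ⊗[k] N) :
    f.rTensor N z = 0 ↔ z ∈ tens (LinearMap.ker f) ⊤ := by
  rw [mem_tens_top_right]
  simp_rw [LinearMap.mem_ker, ← rslice_rTensor]
  exact ⟨fun h => by simp [h], fun h => eq_of_rslice fun g => by simp [h]⟩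

end Slices

/-! ### The convolution algebra and finite-dimensional subcoalgebras -/

section Conv

variable {k C : Type*} [Field k] [AddCommGroup C] [Module k C] [Coalgebra k C]

open Coalgebra

lemma conv_apply_left (f g : WithConv (C →ₗ[k] k)) (x : C) :
    (f * g) x = g (lslice f.ofConv (comul x)) := by
  rw [LinearMap.convMul_apply]
  generalize comul (R := k) x = z
  induction z with
  | zero => simp
  | tmul m n => simp
  | add x y hx hy => simp [hx, hy]

lemma conv_apply_right (f g : WithConv (C →ₗ[k] k)) (x : C) :
    (f * g) x = f (rslice g.ofConv (comul x)) := by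
  rw [LinearMap.convMul_apply]
  generalize comul (R := k) x = z
  induction z with
  | zero => simp
  | tmul m n => simp [mul_comm]
  | add x y hx hy => simp [hx, hy]

lemma lslice_counit_comul (x : C) : lslice (counit (R := k)) (comul (R := k) x) = x := by
  simp [lslice]

lemma rslice_counit_comul (x : C) : rslice (counit (R := k)) (comul (R := k) x) = x := by
  simp [rslice]

lemma isSubcoalgebra_iff {D : Submodule k C} : IsSubcoalgebra k D ↔
    ∀ x ∈ D, (∀ f : C →ₗ[k] k, lslice f (comul (R := k) x) ∈ D) ∧
      ∀ f : C →ₗ[k] k, rslice f (comul (R := k) x) ∈ D := by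
  refine forall₂_congr fun x _ => ?_
  rw [range_map_subtype]
  refine ⟨fun h => ⟨?_, ?_⟩, fun h => mem_tens_of_mem ?_ ?_⟩
  · exact mem_tens_top_left.1 (tens_mono le_top le_rfl h)
  · exact mem_tens_top_right.1 (tens_mono le_rfl le_top h)
  · exact mem_tens_top_right.2 h.2
  · exact mem_tens_top_left.2 h.1

lemma eq_of_dual {M : Type*} [AddCommGroup M] [Module k M] {x y : M}
    (h : ∀ f : M →ₗ[k] k, f x = f y) : x = y := by
  rw [← sub_eq_zero, ← Module.forall_dual_apply_eq_zero_iff k]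
  intro f
  simp [h]

lemma lslice_comul_lslice_comul (f g : WithConv (C →ₗ[k] k)) (x : C) :
    lslice g.ofConv (comul (R := k) (lslice f.ofConv (comul (R := k) x))) =
      lslice (f * g).ofConv (comul (R := k) x) := by
  refine eq_of_dual (k := k) fun h => ?_
  obtain ⟨h, rfl⟩ := WithConv.ofConv_surjective h
  rw [← conv_apply_left, ← conv_apply_left, ← conv_apply_left, mul_assoc]

lemma rslice_comul_rslice_comul (f g : WithConv (C →ₗ[k] k)) (x : C) :
    rslice g.ofConv (comul (R := k) (rslice f.ofConv (comul (R := k) x))) =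
      rslice (g * f).ofConv (comul (R := k) x) := by
  refine eq_of_dual (k := k) fun h => ?_
  obtain ⟨h, rfl⟩ := WithConv.ofConv_surjective h
  rw [← conv_apply_right, ← conv_apply_right, ← conv_apply_right, mul_assoc]

lemma rslice_comul_lslice_comul (f g : WithConv (C →ₗ[k] k)) (x : C) :
    rslice g.ofConv (comul (R := k) (lslice f.ofConv (comul (R := k) x))) =
      lslice f.ofConv (comul (R := k) (rslice g.ofConv (comul (R := k) x))) := by
  refine eq_of_dual (k := k) fun h => ?_
  obtain ⟨h, rfl⟩ := WithConv.ofConv_surjective h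
  rw [← conv_apply_right, ← conv_apply_left, ← conv_apply_left, ← conv_apply_right, mul_assoc]

lemma finite_range_slice {M N : Type*} [AddCommGroup M] [Module k M] [AddCommGroup N] [Module k N]
    (z : M ⊗[k] N) :
    (∃ W : Submodule k N, FiniteDimensional k W ∧ ∀ f : M →ₗ[k] k, lslice f z ∈ W) ∧
    (∃ W : Submodule k M, FiniteDimensional k W ∧ ∀ f : N →ₗ[k] k, rslice f z ∈ W) := by
  induction z with
  | zero => exact ⟨⟨⊥, inferInstance, by simp⟩, ⟨⊥, inferInstance, by simp⟩⟩
  | tmul m n =>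
    refine ⟨⟨k ∙ n, inferInstance, fun f => ?_⟩, ⟨k ∙ m, inferInstance, fun f => ?_⟩⟩
    · simpa using Submodule.smul_mem _ _ (Submodule.mem_span_singleton_self n)
    · simpa using Submodule.smul_mem _ _ (Submodule.mem_span_singleton_self m)
  | add x y hx hy =>
    obtain ⟨⟨W₁, _, h₁⟩, ⟨W₂, _, h₂⟩⟩ := hx
    obtain ⟨⟨W₃, _, h₃⟩, ⟨W₄, _, h₄⟩⟩ := hy
    refine ⟨⟨W₁ ⊔ W₃, inferInstance, fun f => ?_⟩, ⟨W₂ ⊔ W₄, inferInstance, fun f => ?_⟩⟩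
    · simpa using Submodule.add_mem_sup (h₁ f) (h₃ f)
    · simpa using Submodule.add_mem_sup (h₂ f) (h₄ f)

/-- The fundamental theorem of coalgebras: every element lies in a finite-dimensional
subcoalgebra. -/
lemma exists_finiteDimensional_subcoalgebra (x : C) :
    ∃ D : Submodule k C, FiniteDimensional k D ∧ IsSubcoalgebra k D ∧ x ∈ D := by
  classical
  obtain ⟨W, hW, hxW⟩ := (finite_range_slice (comul (R := k) x)).1
  -- a finite-dimensional space that contains all `f(x₁) x₂ g(x₃)`
  have hV : ∃ V : Submodule k C, FiniteDimensional k V ∧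
      ∀ w ∈ W, ∀ f : C →ₗ[k] k, rslice f (comul (R := k) w) ∈ V := by
    let b := Module.finBasis k W
    choose V hV hb using fun i => (finite_range_slice (comul (R := k) (b i : C))).2
    refine ⟨⨆ i, V i, inferInstance, fun w hw f => ?_⟩
    have hw' : (⟨w, hw⟩ : W) ∈ Submodule.comap
        (rslice f ∘ₗ comul (R := k) ∘ₗ W.subtype) (⨆ i, V i) := by
      rw [← b.sum_repr ⟨w, hw⟩]
      refine Submodule.sum_mem _ fun i _ => Submodule.smul_mem _ _ ?_
      exact (le_iSup V i) (hb i f)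
    exact hw'
  obtain ⟨V, hV, hWV⟩ := hV
  let S : Set C := {y | ∃ f g : WithConv (C →ₗ[k] k),
    y = rslice g.ofConv (comul (R := k) (lslice f.ofConv (comul (R := k) x)))}
  have hS : Submodule.span k S ≤ V := by
    rw [Submodule.span_le]
    rintro _ ⟨f, g, rfl⟩
    exact hWV _ (hxW _) _
  refine ⟨Submodule.span k S, Submodule.finiteDimensional_of_le hS, ?_, ?_⟩
  · rw [isSubcoalgebra_iff]
    intro y hy
    refine ⟨fun f => ?_, fun f => ?_⟩
    · obtain ⟨f, rfl⟩ := WithConv.ofConv_surjective f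
      have : Submodule.span k S ≤
          (Submodule.span k S).comap (lslice f.ofConv ∘ₗ comul (R := k)) := by
        rw [Submodule.span_le]
        rintro _ ⟨p, q, rfl⟩
        refine Submodule.subset_span ⟨p * f, q, ?_⟩
        change lslice f.ofConv (comul (R := k) (rslice q.ofConv _)) = _
        rw [← rslice_comul_lslice_comul, lslice_comul_lslice_comul]
      exact this hy
    · obtain ⟨f, rfl⟩ := WithConv.ofConv_surjective f
      have : Submodule.span k S ≤
          (Submodule.span k S).comap (rslice f.ofConv ∘ₗ comul (R := k)) := by
        rw [Submodule.span_le]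
        rintro _ ⟨p, q, rfl⟩
        exact Submodule.subset_span ⟨p, f * q, rslice_comul_rslice_comul _ _ _⟩
      exact this hy
  · refine Submodule.subset_span ⟨.toConv counit, .toConv counit, ?_⟩
    rw [rslice_counit_comul, lslice_counit_comul]

end Conv

/-! ### Simple subcoalgebras and simple quotients of the dual algebra -/

section DualAlgebra

variable {k C : Type*} [Field k] [AddCommGroup C] [Module k C] [Coalgebra k C]

open Coalgebra

lemma exists_dual_separating {M : Type*} [AddCommGroup M] [Module k M] {U : Submodule k M} {x : M}
    (hx : x ∉ U) : ∃ f : M →ₗ[k] k, f x ≠ 0 ∧ ∀ u ∈ U, f u = 0 := by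
  obtain ⟨f, hf, h⟩ := Submodule.exists_le_ker_of_notMem hx
  exact ⟨f, hf, fun u hu => h hu⟩

/-- The ideal of functionals that vanish on a subspace `D` which is stable under left slicing. -/
def annIdeal (D : Submodule k C)
    (hD : ∀ x ∈ D, ∀ f : C →ₗ[k] k, lslice f (comul (R := k) x) ∈ D) :
    Ideal (WithConv (C →ₗ[k] k)) where
  carrier := {f | ∀ x ∈ D, f x = 0}
  zero_mem' := fun x _ => rfl
  add_mem' := fun {f g} hf hg x hx => by
    change f x + g x = 0
    rw [hf x hx, hg x hx, add_zero]
  smul_mem' := fun f g hg x hx => by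
    change (f * g) x = 0
    rw [conv_apply_left]
    exact hg _ (hD x hx _)

lemma annIdeal_isTwoSided {D : Submodule k C} (hD : IsSubcoalgebra k D) :
    (annIdeal D fun x hx => (isSubcoalgebra_iff.1 hD x hx).1).IsTwoSided where
  mul_mem_of_left {f} g hf := by
    intro x hx
    rw [conv_apply_right]
    exact hf _ ((isSubcoalgebra_iff.1 hD x hx).2 _)

/-- The subspace of elements at which all functionals of `P` vanish. -/
def coann (P : Ideal (WithConv (C →ₗ[k] k))) : Submodule k C where
  carrier := {x | ∀ f ∈ P, f x = 0}
  zero_mem' := fun f _ => map_zero f.ofConv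
  add_mem' := fun {x y} hx hy f hf => by
    rw [map_add, hx f hf, hy f hf, add_zero]
  smul_mem' := fun c x hx f hf => by
    rw [map_smul, hx f hf, smul_zero]

lemma isSubcoalgebra_coann (P : Ideal (WithConv (C →ₗ[k] k))) [P.IsTwoSided] :
    IsSubcoalgebra k (coann P) := by
  rw [isSubcoalgebra_iff]
  refine fun x hx => ⟨fun f g hg => ?_, fun f g hg => ?_⟩
  · obtain ⟨f, rfl⟩ := WithConv.ofConv_surjective f
    rw [← conv_apply_left]
    exact hx _ (P.mul_mem_left f hg)
  · obtain ⟨f, rfl⟩ := WithConv.ofConv_surjective f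
    rw [← conv_apply_right]
    exact hx _ (P.mul_mem_right f hg)

/-- An ideal that contains all functionals vanishing on a finite-dimensional space consists of all
functionals that vanish on its coannihilator. -/
lemma mem_of_forall_coann {D : Submodule k C} [FiniteDimensional k D]
    {P : Ideal (WithConv (C →ₗ[k] k))}
    (hP : ∀ f : WithConv (C →ₗ[k] k), (∀ x ∈ D, f x = 0) → f ∈ P)
    {f : WithConv (C →ₗ[k] k)} (hf : ∀ x ∈ coann P, f x = 0) : f ∈ P := by
  let res : (C →ₗ[k] k) →ₗ[k] Module.Dual k D := LinearMap.lcomp k k D.subtype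
  let W : Submodule k (Module.Dual k D) := Submodule.map res
    ((P.restrictScalars k).map (WithConv.linearEquiv k (C →ₗ[k] k)).toLinearMap)
  have hfin : FiniteDimensional k W := FiniteDimensional.finiteDimensional_submodule W
  have hfW : res f.ofConv ∈ W := by
    by_contra hcon
    rw [← Subspace.dualCoannihilator_dualAnnihilator_eq (W := W),
      Submodule.mem_dualAnnihilator] at hcon
    push Not at hcon
    obtain ⟨x, hx, hfx⟩ := hcon
    rw [Submodule.mem_dualCoannihilator] at hx
    refine hfx (hf x fun g hg => ?_)
    exact hx (res g.ofConv) ⟨g.ofConv, ⟨g, hg, rfl⟩, rfl⟩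
  obtain ⟨_, ⟨g, hg, rfl⟩, hgf⟩ := hfW
  have : f = g + (f - g) := by abel
  rw [this]
  refine P.add_mem hg (hP _ fun x hx => ?_)
  have h := LinearMap.congr_fun hgf ⟨x, hx⟩
  change f x - g x = 0
  exact sub_eq_zero.2 h.symm

/-- The coannihilator of the kernel of a map onto a simple ring is a simple subcoalgebra, provided
that the kernel contains all functionals vanishing on a finite-dimensional space. -/
lemma isSimpleSubcoalgebra_coann_ker {D : Submodule k C} [FiniteDimensional k D]
    {S : Type*} [Ring S] [IsSimpleRing S] (g : WithConv (C →ₗ[k] k) →+* S)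
    (hg : Function.Surjective g)
    (hP : ∀ f : WithConv (C →ₗ[k] k), (∀ x ∈ D, f x = 0) → f ∈ RingHom.ker g) :
    IsSimpleSubcoalgebra k (coann (RingHom.ker g)) := by
  refine ⟨isSubcoalgebra_coann _, fun hbot => ?_, fun E hE hEsub => ?_⟩
  · have : (1 : WithConv (C →ₗ[k] k)) ∈ RingHom.ker g := mem_of_forall_coann hP fun x hx => by
      rw [hbot, Submodule.mem_bot] at hx
      rw [hx, map_zero]
    rw [RingHom.mem_ker, map_one] at this
    exact one_ne_zero this
  · by_contra! hne
    obtain ⟨hne₁, hne₂⟩ := hne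
    have hI := annIdeal_isTwoSided hEsub
    set I := annIdeal E fun x hx => (isSubcoalgebra_iff.1 hEsub x hx).1 with hIdef
    -- some functional vanishes on `E` but is not in the kernel
    obtain ⟨x, hx, hxE⟩ := SetLike.exists_of_lt (lt_of_le_of_ne hE hne₂)
    obtain ⟨f, hfx, hfE⟩ := exists_dual_separating hxE
    have hfI : WithConv.toConv f ∈ I := hfE
    have hgf : g (WithConv.toConv f) ≠ 0 := fun h => hfx (hx _ (RingHom.mem_ker.2 h))
    let J : TwoSidedIdeal S := TwoSidedIdeal.mk' {s | ∃ f ∈ I, g f = s}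
      ⟨0, I.zero_mem, map_zero g⟩
      (by rintro _ _ ⟨a, ha, rfl⟩ ⟨b, hb, rfl⟩; exact ⟨a + b, I.add_mem ha hb, map_add g a b⟩)
      (by rintro _ ⟨a, ha, rfl⟩; exact ⟨-a, I.neg_mem ha, map_neg g a⟩)
      (by
        rintro x _ ⟨b, hb, rfl⟩
        obtain ⟨a, rfl⟩ := hg x
        exact ⟨a * b, I.mul_mem_left a hb, map_mul g a b⟩)
      (by
        rintro _ y ⟨a, ha, rfl⟩
        obtain ⟨b, rfl⟩ := hg y
        exact ⟨a * b, I.mul_mem_right b ha, map_mul g a b⟩)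
    have hJ : (1 : S) ∈ J := IsSimpleRing.one_mem_of_ne_zero_mem J hgf
      ((TwoSidedIdeal.mem_mk' _ _ _ _ _ _ _).2 ⟨_, hfI, rfl⟩)
    obtain ⟨e, he, hge⟩ := (TwoSidedIdeal.mem_mk' _ _ _ _ _ _ _).1 hJ
    have h1 : (1 : WithConv (C →ₗ[k] k)) ∈ I := by
      have : (1 : WithConv (C →ₗ[k] k)) = e + (1 - e) := by abel
      rw [this]
      refine I.add_mem he fun x hx => hE hx _ ?_
      rw [RingHom.mem_ker, map_sub, map_one, hge, sub_self]
    refine hne₁ ((Submodule.eq_bot_iff _).2 fun x hx => eq_of_dual (k := k) fun p => ?_)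
    have := (Ideal.eq_top_iff_one _).2 h1
    rw [map_zero]
    exact (this ▸ Submodule.mem_top : WithConv.toConv p ∈ I) x hx

end DualAlgebra

/-! ### Exhaustiveness of the coradical filtration of a connected coalgebra -/

section Filtration

variable (k : Type*) {R : Type*} [Field k] [Ring R] [Algebra k R] [Coalgebra k R]

open Coalgebra

/-- The left ideal of functionals that vanish at `1`, in the convolution algebra of `R`. -/
def augIdeal (h1 : comul (R := k) (1 : R) = 1 ⊗ₜ[k] 1) : Ideal (WithConv (R →ₗ[k] k)) :=
  annIdeal (k ∙ (1 : R)) fun x hx f => by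
    obtain ⟨c, rfl⟩ := Submodule.mem_span_singleton.1 hx
    rw [map_smul, h1, map_smul, lslice_tmul]
    exact Submodule.smul_mem _ _ (Submodule.smul_mem _ _ (Submodule.mem_span_singleton_self _))

/-- The coradical filtration of a connected coalgebra, with an index shift: `filt n` is the space
of elements at which all products of `n` functionals vanishing at `1` vanish. -/
def filt (h1 : comul (R := k) (1 : R) = 1 ⊗ₜ[k] 1) (n : ℕ) : Submodule k R :=
  coann (augIdeal k h1 ^ n)

variable {k}
variable {h1 : comul (R := k) (1 : R) = 1 ⊗ₜ[k] 1}

lemma mem_augIdeal {f : WithConv (R →ₗ[k] k)} : f ∈ augIdeal k h1 ↔ f (1 : R) = 0 := by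
  refine ⟨fun h => h 1 (Submodule.mem_span_singleton_self _), fun h x hx => ?_⟩
  obtain ⟨c, rfl⟩ := Submodule.mem_span_singleton.1 hx
  rw [map_smul, h, smul_zero]

instance : (augIdeal k h1).IsTwoSided where
  mul_mem_of_left {f} g hf := by
    rw [mem_augIdeal] at hf ⊢
    rw [conv_apply_left, h1, lslice_tmul, hf, zero_smul, map_zero]

variable (h1) in
lemma filt_zero : filt k h1 0 = ⊥ := by
  refine (Submodule.eq_bot_iff _).2 fun x hx => eq_of_dual (k := k) fun p => ?_
  rw [map_zero]
  refine hx (.toConv p) ?_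
  rw [Submodule.pow_zero, Ideal.one_eq_top]
  trivial

lemma mem_filt_succ_iff_lslice' {n : ℕ} {r : R} : r ∈ filt k h1 (n + 1) ↔
    ∀ f ∈ augIdeal k h1, lslice f.ofConv (comul (R := k) r) ∈ filt k h1 n := by
  refine ⟨fun h f hf g hg => ?_, fun h g hg => ?_⟩
  · rw [← conv_apply_left]
    exact h _ (by rw [Ideal.IsTwoSided.pow_succ]; exact Ideal.mul_mem_mul hf hg)
  · rw [Ideal.IsTwoSided.pow_succ] at hg
    refine Submodule.smul_induction_on hg (fun a ha b hb => ?_) fun a b ha hb => ?_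
    · rw [smul_eq_mul, conv_apply_left]
      exact h a ha b hb
    · change a r + b r = 0
      rw [ha, hb, add_zero]

lemma mem_filt_succ_iff_rslice' {n : ℕ} {r : R} : r ∈ filt k h1 (n + 1) ↔
    ∀ f ∈ augIdeal k h1, rslice f.ofConv (comul (R := k) r) ∈ filt k h1 n := by
  refine ⟨fun h f hf g hg => ?_, fun h g hg => ?_⟩
  · rw [← conv_apply_right]
    exact h _ (by rw [Submodule.pow_succ]; exact Ideal.mul_mem_mul hg hf)
  · rw [Submodule.pow_succ] at hg
    refine Submodule.smul_induction_on hg (fun a ha b hb => ?_) fun a b ha hb => ?_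
    · rw [smul_eq_mul, conv_apply_right]
      exact h b hb a ha
    · change a r + b r = 0
      rw [ha, hb, add_zero]

lemma mem_filt_succ {n : ℕ} {r : R} (hε : counit (R := k) (1 : R) = 1) :
    r ∈ filt k h1 (n + 1) ↔
      comul (R := k) r - 1 ⊗ₜ[k] r ∈ tens ⊤ (filt k h1 n) := by
  rw [mem_filt_succ_iff_lslice', mem_tens_top_left]
  refine ⟨fun h f => ?_, fun h f hf => ?_⟩
  · have := h (.toConv (f - f 1 • counit)) (by simp [mem_augIdeal, hε])
    have h2 : lslice (f - f 1 • counit) (comul (R := k) r) =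
        lslice f (comul r) - f 1 • lslice counit (comul (R := k) r) := by
      generalize comul (R := k) r = z
      induction z with
      | zero => simp
      | tmul m n => simp [sub_smul, smul_smul]
      | add x y hx hy => simp only [map_add, hx, hy, smul_add]; abel
    rw [map_sub, lslice_tmul]
    rwa [h2, lslice_counit_comul] at this
  · have := h f.ofConv
    rw [mem_augIdeal] at hf
    rwa [map_sub, lslice_tmul, hf, zero_smul, sub_zero] at this

lemma mem_filt_succ' {n : ℕ} {r : R} (hε : counit (R := k) (1 : R) = 1) :
    r ∈ filt k h1 (n + 1) ↔
      comul (R := k) r - r ⊗ₜ[k] 1 ∈ tens (filt k h1 n) ⊤ := by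
  rw [mem_filt_succ_iff_rslice', mem_tens_top_right]
  refine ⟨fun h f => ?_, fun h f hf => ?_⟩
  · have := h (.toConv (f - f 1 • counit)) (by simp [mem_augIdeal, hε])
    have h2 : rslice (f - f 1 • counit) (comul (R := k) r) =
        rslice f (comul r) - f 1 • rslice counit (comul (R := k) r) := by
      generalize comul (R := k) r = z
      induction z with
      | zero => simp
      | tmul m n => simp [sub_smul, smul_smul]
      | add x y hx hy => simp only [map_add, hx, hy, smul_add]; abel
    rw [map_sub, rslice_tmul]
    rwa [h2, rslice_counit_comul] at this
  · have := h f.ofConv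
    rw [mem_augIdeal] at hf
    rwa [map_sub, rslice_tmul, hf, zero_smul, sub_zero] at this

variable (h1) in
lemma filt_mono : Monotone (filt k h1) := by
  refine monotone_nat_of_le_succ fun n x hx f hf => hx f ?_
  exact Ideal.pow_le_pow_right (Nat.le_succ n) hf

lemma filt_one (hε : counit (R := k) (1 : R) = 1) : filt k h1 1 = k ∙ (1 : R) := by
  ext x
  rw [mem_filt_succ hε, filt_zero, tens_top_bot, Submodule.mem_bot, sub_eq_zero]
  refine ⟨fun h => ?_, fun h => ?_⟩
  · have h2 := rslice_counit_comul (k := k) x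
    rw [h, rslice_tmul] at h2
    exact Submodule.mem_span_singleton.2 ⟨_, h2⟩
  · obtain ⟨c, rfl⟩ := Submodule.mem_span_singleton.1 h
    rw [map_smul, h1, TensorProduct.tmul_smul]

/-- An element of an Artinian ring that vanishes in all simple quotient rings lies in the Jacobson
radical. -/
lemma mem_jacobson_of_forall_simple.{u} {Q : Type u} [Ring Q] [IsArtinianRing Q] {x : Q}
    (h : ∀ (S : Type u) [Ring S] [IsSimpleRing S] (g : Q →+* S), Function.Surjective g → g x = 0) :
    x ∈ Ring.jacobson Q := by
  obtain ⟨m, Δ, d, _, hd, ⟨e⟩⟩ :=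
    IsSemisimpleRing.exists_ringEquiv_pi_matrix_divisionRing (Q ⧸ Ring.jacobson Q)
  rw [← Ideal.Quotient.eq_zero_iff_mem]
  apply e.injective
  rw [map_zero]
  ext1 i
  exact h _ ((Pi.evalRingHom _ i).comp (e.toRingHom.comp (Ideal.Quotient.mk (Ring.jacobson Q))))
    ((Function.surjective_eval i).comp (e.surjective.comp Ideal.Quotient.mk_surjective))

/-- In a connected coalgebra every element lies in some term of the coradical filtration. The
functionals on a finite-dimensional subcoalgebra `D` form a finite-dimensional algebra; the kernels
of its maps to the simple blocks of its semisimple quotient correspond to simple subcoalgebras, that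
is, to `k 1`, so that functionals vanishing at `1` restrict to elements of the Jacobson radical. -/
lemma exists_mem_filt (hR : IsConnected k R) (r : R) : ∃ n, r ∈ filt k h1 n := by
  obtain ⟨D, hfin, hD, hrD⟩ := exists_finiteDimensional_subcoalgebra (k := k) r
  have hI := annIdeal_isTwoSided hD
  set I := annIdeal D fun x hx => (isSubcoalgebra_iff.1 hD x hx).1 with hIdef
  let Q := WithConv (R →ₗ[k] k) ⧸ I
  have hQ : FiniteDimensional k Q := by
    let res : Q →ₗ[k] Module.Dual k D := Submodule.liftQ (I.restrictScalars k)
      ((LinearMap.lcomp k k D.subtype) ∘ₗ (WithConv.linearEquiv k (R →ₗ[k] k)).toLinearMap)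
      (fun f hf => LinearMap.ext fun x => hf x.1 x.2)
    refine Module.Finite.of_injective res ?_
    refine LinearMap.ker_eq_bot.1 (Submodule.ker_liftQ_eq_bot _ _ _ ?_)
    intro f hf x hx
    exact LinearMap.congr_fun hf ⟨x, hx⟩
  have hart : IsArtinianRing Q := isArtinian_of_tower k inferInstance
  have key : ∀ f ∈ augIdeal k h1, Ideal.Quotient.mk I f ∈ Ring.jacobson Q := by
    refine fun f hf => mem_jacobson_of_forall_simple fun S _ _ p hp => ?_
    let g : WithConv (R →ₗ[k] k) →+* S := p.comp (Ideal.Quotient.mk I)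
    have hg : Function.Surjective g := hp.comp Ideal.Quotient.mk_surjective
    have hP : ∀ f : WithConv (R →ₗ[k] k), (∀ x ∈ D, f x = 0) → f ∈ RingHom.ker g := by
      intro f hf
      have : Ideal.Quotient.mk I f = 0 := Ideal.Quotient.eq_zero_iff_mem.2 hf
      simp [g, RingHom.mem_ker, this]
    have hsimple := isSimpleSubcoalgebra_coann_ker g hg hP
    have hle : coann (RingHom.ker g) ≤ k ∙ (1 : R) := by
      rw [← hR]
      exact le_sSup hsimple
    exact mem_of_forall_coann hP fun x hx => hf x (hle hx)
  obtain ⟨n, hn⟩ := IsSemiprimaryRing.isNilpotent (R := Q)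
  refine ⟨n, fun f hf => ?_⟩
  have hpow : ∀ n, ∀ f ∈ augIdeal k h1 ^ n, Ideal.Quotient.mk I f ∈ Ring.jacobson Q ^ n := by
    intro n
    induction n with
    | zero => intro f _; rw [Submodule.pow_zero, Ideal.one_eq_top]; trivial
    | succ n ih =>
      intro f hf
      rw [Submodule.pow_succ] at hf ⊢
      refine Submodule.smul_induction_on hf (fun a ha b hb => ?_) fun a b ha hb => ?_
      · rw [smul_eq_mul, map_mul]
        exact Ideal.mul_mem_mul (ih a ha) (key b hb)
      · rw [map_add]
        exact Ideal.add_mem _ ha hb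
  have := hpow n f hf
  rw [hn, Submodule.zero_eq_bot, Submodule.mem_bot, Ideal.Quotient.eq_zero_iff_mem] at this
  exact this r hrD

end Filtration

/-! ### Calculus in Yetter–Drinfeld Hopf algebras -/

section YDCalculus

open Coalgebra

variable {k H R : Type*} [Field k] [Ring H] [HopfAlgebra k H]

section Modules

variable {V : Type*} [AddCommGroup V] [Module k V] [Module H V] [IsScalarTower k H V]

variable (k H) in
/-- The orbit map `h ↦ h • v`. -/
def orbitMap (v : V) : H →ₗ[k] V := (LinearMap.toSpanSingleton H V v).restrictScalars k

@[simp] lemma orbitMap_apply (v : V) (h : H) : orbitMap k H v h = h • v := rfl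

@[simp] lemma actMap_tmul (h : H) (v : V) : actMap k H V (h ⊗ₜ v) = h • v := rfl

lemma isYDSubmodule_iff [YetterDrinfeldModule k H V] {U : Submodule k V} :
    IsYDSubmodule H U ↔ (∀ h : H, ∀ v ∈ U, h • v ∈ U) ∧ ∀ v ∈ U, coact k H V v ∈ tens ⊤ U := by
  rw [← range_lTensor_subtype]
  exact ⟨fun h => ⟨h.1, h.2⟩, fun h => ⟨h.1, h.2⟩⟩

lemma diagActMap_tmul {W : Type*} [AddCommGroup W] [Module k W] [Module H W] [IsScalarTower k H W]
    (h : H) (v : V) (w : W) : diagActMap k H V W (h ⊗ₜ (v ⊗ₜ w)) =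
      TensorProduct.map (orbitMap k H v) (orbitMap k H w) (comul (R := k) h) := by
  simp only [diagActMap, LinearMap.comp_apply, LinearMap.rTensor_tmul]
  generalize comul (R := k) h = z
  induction z with
  | zero => simp
  | tmul a b => simp
  | add x y hx hy => simp only [TensorProduct.add_tmul, map_add, hx, hy]

lemma map_coact_coassoc [YetterDrinfeldModule k H V] {P : Type*} [AddCommGroup P] [Module k P]
    (Φ : H ⊗[k] (H ⊗[k] V) →ₗ[k] P) (v : V) :
    Φ ((coact k H V).lTensor H (coact k H V v)) =
      Φ ((TensorProduct.assoc k H H V) ((comul (R := k)).rTensor V (coact k H V v))) :=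
  congrArg Φ (LinearMap.congr_fun (YetterDrinfeldModule.coact_coassoc (k := k) (H := H)) v).symm

lemma lslice_counit_coact [YetterDrinfeldModule k H V] (v : V) :
    lslice (counit (R := k)) (coact k H V v) = v := by
  have := LinearMap.congr_fun (YetterDrinfeldModule.coact_counit (k := k) (H := H)) v
  change (TensorProduct.lid k V) ((counit (R := k)).rTensor V (coact k H V v)) = v
  change (counit (R := k)).rTensor V (coact k H V v) = 1 ⊗ₜ v at this
  rw [this, TensorProduct.lid_tmul, one_smul]

variable {W : Type*} [AddCommGroup W] [Module k W] [Module H W] [IsScalarTower k H W]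

lemma braiding_tmul [YetterDrinfeldModule k H V] [YetterDrinfeldModule k H W] (v : V) (w : W) :
    braiding k H V W (v ⊗ₜ w) =
      TensorProduct.map (orbitMap k H w) LinearMap.id (coact k H V v) := by
  simp only [braiding, LinearMap.comp_apply, LinearMap.rTensor_tmul]
  generalize coact k H V v = z
  induction z with
  | zero => simp
  | tmul a b => simp
  | add x y hx hy => simp only [TensorProduct.add_tmul, map_add, hx, hy]

end Modules

variable [Ring R] [Algebra k R] [Module H R] [IsScalarTower k H R]

lemma diagActMap_mem {U V U' V' : Submodule k R} (hU : ∀ h : H, ∀ u ∈ U, h • u ∈ U')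
    (hV : ∀ h : H, ∀ v ∈ V, h • v ∈ V') {z : R ⊗[k] R} (hz : z ∈ tens U V) (h : H) :
    diagActMap k H R R (h ⊗ₜ z) ∈ tens U' V' := by
  refine tens_induction (diagActMap k H R R ∘ₗ TensorProduct.mk k _ _ h) _ (fun u hu v hv => ?_) hz
  change diagActMap k H R R (h ⊗ₜ (u ⊗ₜ v)) ∈ _
  rw [diagActMap_tmul]
  refine tens_induction (U := ⊤) (V := ⊤) _ _
    (fun a _ b _ => tmul_mem_tens (hU a u hu) (hV b v hv)) ?_
  rw [tens_top_top]; trivial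

lemma smul_mem_comap {D : R →ₗ[k] R ⊗[k] R}
    (hD : ∀ (h : H) (r : R), D (h • r) = diagActMap k H R R (h ⊗ₜ D r))
    {U V : Submodule k R} (hU : ∀ h : H, ∀ u ∈ U, h • u ∈ U) (hV : ∀ h : H, ∀ v ∈ V, h • v ∈ V) :
    ∀ h : H, ∀ r ∈ (tens U V).comap D, h • r ∈ (tens U V).comap D := by
  intro h r hr
  rw [Submodule.mem_comap, hD]
  exact diagActMap_mem hU hV hr h

variable [YetterDrinfeldModule k H R]

/-- The braided multiplication `(a ⊗ s)(c ⊗ d) = a (s₍₋₁₎ • c) ⊗ s₍₀₎ d`, as a function of the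
coaction of `s`. -/
lemma braidedMul_tmul (a s c d : R) : braidedMul k H R ((a ⊗ₜ s) ⊗ₜ (c ⊗ₜ d)) =
    TensorProduct.map (LinearMap.mulLeft k a ∘ₗ orbitMap k H c) (LinearMap.mulRight k d)
      (coact k H R s) := by
  simp only [braidedMul, LinearMap.comp_apply, LinearEquiv.coe_coe, TensorProduct.assoc_tmul,
    LinearMap.lTensor_tmul, TensorProduct.assoc_symm_tmul, LinearMap.rTensor_tmul, braiding_tmul]
  generalize coact k H R s = z
  induction z with
  | zero => simp
  | tmul a b => simp
  | add x y hx hy => simp only [TensorProduct.add_tmul, TensorProduct.tmul_add, map_add, hx, hy]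

/-- `(U ⊗ V)(U' ⊗ V') ⊆ W ⊗ W'` for the braided multiplication of `R ⊗ R`, if `V` is a subcomodule,
`U (H • U') ⊆ W`, and `V V' ⊆ W'`. -/
lemma braidedMul_mem {U V U' V' W W' : Submodule k R}
    (hV : ∀ s ∈ V, coact k H R s ∈ tens ⊤ V)
    (hU : ∀ a ∈ U, ∀ h : H, ∀ c ∈ U', a * (h • c) ∈ W) (hV' : ∀ s ∈ V, ∀ d ∈ V', s * d ∈ W')
    {z w : R ⊗[k] R} (hz : z ∈ tens U V) (hw : w ∈ tens U' V') :
    braidedMul k H R (z ⊗ₜ w) ∈ tens W W' := by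
  refine tens_induction ((braidedMul k H R) ∘ₗ (TensorProduct.mk k _ _).flip w) _
    (fun a ha s hs => ?_) hz
  refine tens_induction ((braidedMul k H R) ∘ₗ (TensorProduct.mk k _ _ (a ⊗ₜ s))) _
    (fun c hc d hd => ?_) hw
  change braidedMul k H R ((a ⊗ₜ s) ⊗ₜ (c ⊗ₜ d)) ∈ _
  rw [braidedMul_tmul]
  exact tens_induction _ _ (fun h _ v hv => tmul_mem_tens (hU a ha h c hc) (hV' v hv d hd))
    (hV s hs)

lemma coact_mem_top {s : R} (_ : s ∈ (⊤ : Submodule k R)) :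
    coact k H R s ∈ tens ⊤ (⊤ : Submodule k R) := by
  rw [tens_top_top]; trivial

lemma braidedMul_one_one (b x : R) :
    braidedMul k H R ((1 ⊗ₜ b) ⊗ₜ (x ⊗ₜ 1)) = braiding k H R R (b ⊗ₜ x) := by
  rw [braidedMul_tmul, braiding_tmul]
  congr 2 <;> ext <;> simp

lemma codiagCoact_mem {U V U' V' : Submodule k R} (hU : ∀ u ∈ U, coact k H R u ∈ tens ⊤ U')
    (hV : ∀ v ∈ V, coact k H R v ∈ tens ⊤ V') {z : R ⊗[k] R} (hz : z ∈ tens U V) :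
    codiagCoact k H R R z ∈ tens ⊤ (tens U' V') := by
  refine tens_induction _ _ (fun u hu v hv => ?_) hz
  simp only [codiagCoact, LinearMap.comp_apply, TensorProduct.map_tmul]
  refine tens_induction ((LinearMap.mul' k H).rTensor (R ⊗[k] R) ∘ₗ
    (TensorProduct.tensorTensorTensorComm k H R H R).toLinearMap ∘ₗ
      (TensorProduct.mk k _ _).flip (coact k H R v)) _ (fun h _ u' hu' => ?_) (hU u hu)
  refine tens_induction ((LinearMap.mul' k H).rTensor (R ⊗[k] R) ∘ₗ
    (TensorProduct.tensorTensorTensorComm k H R H R).toLinearMap ∘ₗ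
      (TensorProduct.mk k _ _) (h ⊗ₜ u')) _ (fun h' _ v' hv' => ?_) (hV v hv)
  simpa using tmul_mem_tens (U := ⊤) (Submodule.mem_top (x := h * h')) (tmul_mem_tens hu' hv')

/-- Preimages of `U ⊗ V` under a colinear map `R → R ⊗ R` are subcomodules. -/
lemma coact_mem_comap {D : R →ₗ[k] R ⊗[k] R}
    (hD : ∀ r, D.lTensor H (coact k H R r) = codiagCoact k H R R (D r))
    {U V : Submodule k R} (hU : ∀ u ∈ U, coact k H R u ∈ tens ⊤ U)
    (hV : ∀ v ∈ V, coact k H R v ∈ tens ⊤ V) :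
    ∀ r ∈ (tens U V).comap D, coact k H R r ∈ tens ⊤ ((tens U V).comap D) := by
  intro r hr
  rw [mem_tens_top_left]
  intro f
  rw [Submodule.mem_comap, ← lslice_lTensor, hD]
  exact mem_tens_top_left.1 (codiagCoact_mem hU hV hr) f

lemma isYDSubmodule_top : IsYDSubmodule H (⊤ : Submodule k R) :=
  isYDSubmodule_iff.2 ⟨fun _ _ _ => trivial, fun _ => coact_mem_top⟩

lemma isYDSubmodule_bot : IsYDSubmodule H (⊥ : Submodule k R) := by
  rw [isYDSubmodule_iff]
  refine ⟨fun h v hv => ?_, fun v hv => ?_⟩ <;> rw [Submodule.mem_bot] at hv <;> subst hv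
  · rw [smul_zero]; exact Submodule.zero_mem _
  · rw [map_zero]; exact Submodule.zero_mem _

/-! ### The inverse braiding -/

/-- The inverse `S` of the antipode satisfies the antipode identities for the opposite
comultiplication: `h₂ S(h₁) = ε(h) = S(h₂) h₁`. -/
lemma mul_inv_antipode {S : H →ₗ[k] H} (hS : ∀ h, HopfAlgebra.antipode k (S h) = h)
    (hS' : ∀ h, S (HopfAlgebra.antipode k h) = h) (h : H) :
    LinearMap.mul' k H (TensorProduct.map LinearMap.id S
      (TensorProduct.comm k H H (comul (R := k) h))) = algebraMap k H (counit (R := k) h) ∧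
    LinearMap.mul' k H (TensorProduct.map S LinearMap.id
      (TensorProduct.comm k H H (comul (R := k) h))) = algebraMap k H (counit (R := k) h) := by
  have hinj : Function.Injective (HopfAlgebra.antipode k (A := H)) :=
    Function.LeftInverse.injective hS'
  constructor
  · apply hinj
    rw [Algebra.algebraMap_eq_smul_one, map_smul, HopfAlgebra.antipode_one,
      ← Algebra.algebraMap_eq_smul_one, ← HopfAlgebra.mul_antipode_lTensor_comul_apply]
    generalize comul (R := k) h = z
    induction z with
    | zero => simp
    | tmul a b => simp [HopfAlgebra.antipode_mul_antidistrib, hS]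
    | add x y hx hy => simp only [map_add, hx, hy]
  · apply hinj
    rw [Algebra.algebraMap_eq_smul_one, map_smul, HopfAlgebra.antipode_one,
      ← Algebra.algebraMap_eq_smul_one, ← HopfAlgebra.mul_antipode_rTensor_comul_apply]
    generalize comul (R := k) h = z
    induction z with
    | zero => simp
    | tmul a b => simp [HopfAlgebra.antipode_mul_antidistrib, hS]
    | add x y hx hy => simp only [map_add, hx, hy]

/-- The map `u ⊗ v ↦ v₍₀₎ ⊗ S(v₍₋₁₎) • u`, the inverse of the braiding when `S` is the inverse of
the antipode. -/
def invBraiding (S : H →ₗ[k] H) : R ⊗[k] R →ₗ[k] R ⊗[k] R :=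
  (TensorProduct.comm k R R).toLinearMap ∘ₗ (actMap k H R).rTensor R ∘ₗ
    (TensorProduct.rightComm k H R R).toLinearMap ∘ₗ (S.rTensor R ∘ₗ coact k H R).rTensor R ∘ₗ
      (TensorProduct.comm k R R).toLinearMap

lemma invBraiding_tmul (S : H →ₗ[k] H) (u v : R) : invBraiding S (u ⊗ₜ v) =
    TensorProduct.comm k R R
      (TensorProduct.map (orbitMap k H u ∘ₗ S) LinearMap.id (coact k H R v)) := by
  simp only [invBraiding, LinearMap.comp_apply, LinearEquiv.coe_coe, TensorProduct.comm_tmul,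
    LinearMap.rTensor_tmul]
  generalize coact k H R v = z
  induction z with
  | zero => simp
  | tmul a b => simp
  | add x y hx hy => simp only [TensorProduct.add_tmul, map_add, hx, hy]

lemma invBraiding_mem (S : H →ₗ[k] H) {U V : Submodule k R} (hU : ∀ h : H, ∀ u ∈ U, h • u ∈ U)
    (hV : ∀ v ∈ V, coact k H R v ∈ tens ⊤ V) {z : R ⊗[k] R} (hz : z ∈ tens U V) :
    invBraiding S z ∈ tens V U := by
  refine tens_induction _ _ (fun u hu v hv => ?_) hz
  rw [invBraiding_tmul]
  exact tens_induction ((TensorProduct.comm k R R).toLinearMap ∘ₗ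
      (TensorProduct.map (orbitMap k H u ∘ₗ S) LinearMap.id)) _
    (fun h _ w hw => tmul_mem_tens hw (hU _ u hu)) (hV v hv)

lemma braiding_invBraiding {S : H →ₗ[k] H} (hS : ∀ h, HopfAlgebra.antipode k (S h) = h)
    (hS' : ∀ h, S (HopfAlgebra.antipode k h) = h) (z : R ⊗[k] R) :
    braiding k H R R (invBraiding S z) = z := by
  induction z with
  | zero => simp
  | add x y hx hy => simp only [map_add, hx, hy]
  | tmul u v =>
    -- the map `h ⊗ (h' ⊗ w) ↦ h' • S(h) • u ⊗ w`
    let Φ : H ⊗[k] (H ⊗[k] R) →ₗ[k] R ⊗[k] R :=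
      TensorProduct.map (orbitMap k H u ∘ₗ LinearMap.mul' k H ∘ₗ
        TensorProduct.map LinearMap.id S ∘ₗ (TensorProduct.comm k H H).toLinearMap) LinearMap.id ∘ₗ
        (TensorProduct.assoc k H H R).symm.toLinearMap
    have h1 : braiding k H R R (invBraiding S (u ⊗ₜ v)) =
        Φ ((coact k H R).lTensor H (coact k H R v)) := by
      rw [invBraiding_tmul]
      generalize coact k H R v = y
      induction y with
      | zero => simp
      | add x y hx hy => simp only [map_add, hx, hy]
      | tmul h w =>
        simp only [TensorProduct.map_tmul, TensorProduct.comm_tmul, braiding_tmul,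
          LinearMap.lTensor_tmul, LinearMap.id_apply]
        generalize coact k H R w = y
        induction y with
        | zero => simp
        | add x y hx hy => simp only [map_add, hx, hy, TensorProduct.tmul_add]
        | tmul h' w => simp [Φ, mul_smul]
    rw [h1, map_coact_coassoc]
    conv_rhs => rw [← lslice_counit_coact (k := k) (H := H) v]
    generalize coact k H R v = y
    induction y with
    | zero => simp
    | add x y hx hy => simp only [map_add, hx, hy, TensorProduct.tmul_add]
    | tmul h w =>
      have := (mul_inv_antipode hS hS' h).1
      simp [Φ, this, TensorProduct.smul_tmul]

lemma invBraiding_braiding {S : H →ₗ[k] H} (hS : ∀ h, HopfAlgebra.antipode k (S h) = h)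
    (hS' : ∀ h, S (HopfAlgebra.antipode k h) = h) (z : R ⊗[k] R) :
    invBraiding S (braiding k H R R z) = z := by
  induction z with
  | zero => simp
  | add x y hx hy => simp only [map_add, hx, hy]
  | tmul v u =>
    -- the map `h ⊗ (h' ⊗ w) ↦ w ⊗ S(h') • h • u`
    let Φ : H ⊗[k] (H ⊗[k] R) →ₗ[k] R ⊗[k] R :=
      (TensorProduct.comm k R R).toLinearMap ∘ₗ
      TensorProduct.map (orbitMap k H u ∘ₗ LinearMap.mul' k H ∘ₗ
        TensorProduct.map S LinearMap.id ∘ₗ (TensorProduct.comm k H H).toLinearMap) LinearMap.id ∘ₗ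
        (TensorProduct.assoc k H H R).symm.toLinearMap
    have h1 : invBraiding S (braiding k H R R (v ⊗ₜ u)) =
        Φ ((coact k H R).lTensor H (coact k H R v)) := by
      rw [braiding_tmul]
      generalize coact k H R v = y
      induction y with
      | zero => simp
      | add x y hx hy => simp only [map_add, hx, hy]
      | tmul h w =>
        simp only [TensorProduct.map_tmul, invBraiding_tmul,
          LinearMap.lTensor_tmul, LinearMap.id_apply]
        generalize coact k H R w = y
        induction y with
        | zero => simp
        | add x y hx hy => simp only [map_add, hx, hy, TensorProduct.tmul_add]
        | tmul h' w => simp [Φ, mul_smul]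
    rw [h1, map_coact_coassoc]
    conv_rhs => rw [← lslice_counit_coact (k := k) (H := H) v]
    generalize coact k H R v = y
    induction y with
    | zero => simp
    | add x y hx hy => simp only [map_add, hx, hy, TensorProduct.add_tmul]
    | tmul h w =>
      have := (mul_inv_antipode hS hS' h).2
      simp [Φ, this, TensorProduct.smul_tmul]

/-! ### Morphism properties of the structure maps -/

variable [Coalgebra k R] [YDHopfAlgebra k H R]

lemma orbitMap_one : orbitMap k H (1 : R) =
    (LinearMap.toSpanSingleton k R 1) ∘ₗ counit (R := k) (A := H) :=
  LinearMap.ext fun h => YDHopfAlgebra.smul_one h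

lemma braidedMul_one_tmul (z : R ⊗[k] R) (d : R) :
    braidedMul k H R (z ⊗ₜ (1 ⊗ₜ d)) = (LinearMap.mulRight k d).lTensor R z := by
  induction z with
  | zero => simp
  | tmul a s =>
    rw [braidedMul_tmul, orbitMap_one]
    conv_rhs => rw [← lslice_counit_coact (k := k) (H := H) s]
    generalize coact k H R s = y
    induction y with
    | zero => simp
    | tmul h v => simp [TensorProduct.smul_tmul]
    | add x y hx hy => simp only [map_add, hx, hy, TensorProduct.tmul_add]
  | add x y hx hy => simp only [TensorProduct.add_tmul, map_add, hx, hy]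

lemma braidedMul_tmul_one (a : R) (w : R ⊗[k] R) :
    braidedMul k H R ((a ⊗ₜ 1) ⊗ₜ w) = (LinearMap.mulLeft k a).rTensor R w := by
  induction w with
  | zero => simp
  | tmul c d =>
    rw [braidedMul_tmul]
    have : coact k H R 1 = 1 ⊗ₜ[k] 1 := YDHopfAlgebra.coact_one
    simp [this]
  | add x y hx hy => simp only [TensorProduct.tmul_add, map_add, hx, hy]

lemma comul_mul (r s : R) : comul (R := k) (r * s) =
    braidedMul k H R (comul (R := k) r ⊗ₜ comul (R := k) s) :=
  YDHopfAlgebra.comul_mul r s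

lemma comul_one' (k H : Type*) {R : Type*} [Field k] [Ring H] [HopfAlgebra k H]
    [Ring R] [Algebra k R] [Coalgebra k R] [Module H R] [IsScalarTower k H R]
    [YetterDrinfeldModule k H R] [YDHopfAlgebra k H R] :
    comul (R := k) (1 : R) = 1 ⊗ₜ[k] 1 :=
  YDHopfAlgebra.comul_one (H := H)

lemma counit_one' (k H : Type*) {R : Type*} [Field k] [Ring H] [HopfAlgebra k H]
    [Ring R] [Algebra k R] [Coalgebra k R] [Module H R] [IsScalarTower k H R]
    [YetterDrinfeldModule k H R] [YDHopfAlgebra k H R] :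
    counit (R := k) (1 : R) = 1 :=
  YDHopfAlgebra.counit_one (H := H)

variable (k R) in
/-- The map `r ↦ Δ(r) - 1 ⊗ r`. -/
def deltaL : R →ₗ[k] R ⊗[k] R := comul - TensorProduct.mk k R R 1

variable (k R) in
/-- The map `r ↦ Δ(r) - r ⊗ 1`. -/
def deltaR : R →ₗ[k] R ⊗[k] R := comul - (TensorProduct.mk k R R).flip 1

lemma comul_smul (h : H) (r : R) :
    comul (R := k) (h • r) = diagActMap k H R R (h ⊗ₜ comul (R := k) r) :=
  LinearMap.congr_fun (YDHopfAlgebra.comul_act (k := k) (H := H) (R := R)) (h ⊗ₜ r)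

lemma deltaL_smul (h : H) (r : R) :
    deltaL k R (h • r) = diagActMap k H R R (h ⊗ₜ deltaL k R r) := by
  simp only [deltaL, LinearMap.sub_apply, comul_smul, TensorProduct.tmul_sub, map_sub,
    TensorProduct.mk_apply, diagActMap_tmul, orbitMap_one]
  congr 1
  conv_lhs => rw [← lslice_counit_comul (k := k) h]
  generalize comul (R := k) h = z
  induction z with
  | zero => simp
  | tmul a b => simp [TensorProduct.smul_tmul]
  | add x y hx hy => simp only [map_add, hx, hy, TensorProduct.tmul_add, add_smul]

lemma deltaR_smul (h : H) (r : R) :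
    deltaR k R (h • r) = diagActMap k H R R (h ⊗ₜ deltaR k R r) := by
  simp only [deltaR, LinearMap.sub_apply, comul_smul, TensorProduct.tmul_sub, map_sub,
    TensorProduct.mk_apply, LinearMap.flip_apply, diagActMap_tmul, orbitMap_one]
  congr 1
  conv_lhs => rw [← rslice_counit_comul (k := k) h]
  generalize comul (R := k) h = z
  induction z with
  | zero => simp
  | tmul a b => simp [TensorProduct.smul_tmul]
  | add x y hx hy => simp only [map_add, hx, hy, TensorProduct.add_tmul, add_smul]

lemma lTensor_comul_coact (r : R) : (comul (R := k)).lTensor H (coact k H R r) =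
    codiagCoact k H R R (comul (R := k) r) :=
  LinearMap.congr_fun (YDHopfAlgebra.comul_coact (k := k) (H := H) (R := R)) r

lemma deltaL_coact (r : R) :
    (deltaL k R).lTensor H (coact k H R r) = codiagCoact k H R R (deltaL k R r) := by
  have h1 : coact k H R 1 = 1 ⊗ₜ[k] 1 := YDHopfAlgebra.coact_one
  simp only [deltaL, LinearMap.lTensor_sub, LinearMap.sub_apply, lTensor_comul_coact, map_sub]
  congr 1
  simp only [codiagCoact, LinearMap.comp_apply, TensorProduct.map_tmul, TensorProduct.mk_apply, h1]
  generalize coact k H R r = z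
  induction z with
  | zero => simp
  | tmul a b => simp
  | add x y hx hy => simp only [map_add, hx, hy, TensorProduct.tmul_add]

lemma deltaR_coact (r : R) :
    (deltaR k R).lTensor H (coact k H R r) = codiagCoact k H R R (deltaR k R r) := by
  have h1 : coact k H R 1 = 1 ⊗ₜ[k] 1 := YDHopfAlgebra.coact_one
  simp only [deltaR, LinearMap.lTensor_sub, LinearMap.sub_apply, lTensor_comul_coact, map_sub]
  congr 1
  simp only [codiagCoact, LinearMap.comp_apply, TensorProduct.map_tmul, TensorProduct.mk_apply,
    LinearMap.flip_apply, h1]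
  generalize coact k H R r = z
  induction z with
  | zero => simp
  | tmul a b => simp
  | add x y hx hy => simp only [map_add, hx, hy, TensorProduct.add_tmul]

lemma isYDSubmodule_comap_deltaL {U V : Submodule k R} (hU : IsYDSubmodule H U)
    (hV : IsYDSubmodule H V) : IsYDSubmodule H ((tens U V).comap (deltaL k R)) := by
  rw [isYDSubmodule_iff] at *
  exact ⟨smul_mem_comap deltaL_smul hU.1 hV.1, coact_mem_comap deltaL_coact hU.2 hV.2⟩

lemma isYDSubmodule_comap_deltaR {U V : Submodule k R} (hU : IsYDSubmodule H U)
    (hV : IsYDSubmodule H V) : IsYDSubmodule H ((tens U V).comap (deltaR k R)) := by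
  rw [isYDSubmodule_iff] at *
  exact ⟨smul_mem_comap deltaR_smul hU.1 hV.1, coact_mem_comap deltaR_coact hU.2 hV.2⟩

variable (k H R) in
/-- The coradical filtration of a connected Hopf algebra in the category of Yetter–Drinfeld
modules, with `F 0 = 0` and `F 1 = k 1`. -/
def F (n : ℕ) : Submodule k R := filt k (comul_one' k H (R := R)) n

lemma F_zero : F k H R 0 = ⊥ := filt_zero _

lemma F_mono : Monotone (F k H R) := filt_mono _

lemma F_one : F k H R 1 = k ∙ (1 : R) := filt_one (counit_one' k H)

lemma F_succ_eq (n : ℕ) : F k H R (n + 1) = (tens ⊤ (F k H R n)).comap (deltaL k R) :=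
  Submodule.ext fun _ => mem_filt_succ (counit_one' k H)

lemma F_succ_eq' (n : ℕ) : F k H R (n + 1) = (tens (F k H R n) ⊤).comap (deltaR k R) :=
  Submodule.ext fun _ => mem_filt_succ' (counit_one' k H)

lemma isYDSubmodule_F (n : ℕ) : IsYDSubmodule H (F k H R n) := by
  induction n with
  | zero => rw [F_zero]; exact isYDSubmodule_bot
  | succ n ih => rw [F_succ_eq]; exact isYDSubmodule_comap_deltaL isYDSubmodule_top ih

lemma exists_mem_F (hR : IsConnected k R) (r : R) : ∃ n, r ∈ F k H R n := exists_mem_filt hR r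

end YDCalculus

/-! ### Bases of filtered modules -/

section FilteredBasis

/-- A filtration `N` of an `A`-module `M` and a filtration `G` of `A`, both by vector spaces, yield
an `A`-basis of `M` adapted to the spans `A (N n)`, provided that the leading terms of a combination
`∑ aᵢ xᵢ` determine the tensor `∑ aᵢ ⊗ xᵢ`: if `∑ aᵢ xᵢ` lies in `A (N n)`, where
`aᵢ ∈ G (m + 1)` and `xᵢ ∈ N (n + 1)`, then `∑ aᵢ ⊗ xᵢ` lies in `A ⊗ A (N n) + G m ⊗ M`. The last
condition is stated in terms of the functionals on `M` that vanish on `A (N n)`. -/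
theorem exists_filtered_basis.{u, v, w} {k : Type u} {A : Type v} {M : Type w} [Field k] [Ring A]
    [Algebra k A] [AddCommGroup M] [Module k M] [Module A M] [IsScalarTower k A M]
    (N : ℕ → Submodule k M) (hN0 : N 0 = ⊥) (hNm : Monotone N) (hNe : ∀ x, ∃ n, x ∈ N n)
    (G : ℕ → Submodule k A) (hG0 : G 0 = ⊥) (hGm : Monotone G) (hGe : ∀ x, ∃ n, x ∈ G n)
    (hP : ∀ n m, ∀ z ∈ tens (G (m + 1)) (N (n + 1)),
      TensorProduct.lift (Algebra.lsmul k k M : A →ₐ[k] Module.End k M).toLinearMap z ∈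
        Submodule.span A (N n : Set M) →
      ∀ φ : M →ₗ[k] k, (∀ y ∈ Submodule.span A (N n : Set M), φ y = 0) → rslice φ z ∈ G m) :
    ∃ (ι : Type w) (b : Module.Basis ι A M) (deg : ι → ℕ), (∀ i, b i ∈ N (deg i + 1)) ∧
      ∀ n, ∀ x ∈ N n, x ∈ Submodule.span A (b '' {i | deg i < n}) := by
  classical
  let F : ℕ → Submodule k M := fun n => (Submodule.span A (N n : Set M)).restrictScalars k
  -- a `k`-basis of the image of `N (n + 1)` in `M / F n`, and lifts of it
  let c := fun n => Module.Basis.ofVectorSpace k ((N (n + 1)).map (F n).mkQ)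
  have hlift : ∀ n j, ∃ x ∈ N (n + 1), (F n).mkQ x = c n j := fun n j => (c n j).2
  choose x hxN hxc using hlift
  let X : (Σ n, Module.Basis.ofVectorSpaceIndex k ((N (n + 1)).map (F n).mkQ)) → M :=
    fun p => x p.1 p.2
  have dual : ∀ n j₀, ∃ φ : M →ₗ[k] k, (∀ y ∈ F n, φ y = 0) ∧
      ∀ j, φ (x n j) = if j = j₀ then 1 else 0 := by
    intro n j₀
    obtain ⟨ψ, hψ⟩ := LinearMap.exists_extend ((c n).coord j₀)
    refine ⟨ψ ∘ₗ (F n).mkQ, fun y hy => ?_, fun j => ?_⟩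
    · rw [LinearMap.comp_apply, Submodule.mkQ_apply, (Submodule.Quotient.mk_eq_zero _).2 hy,
        map_zero]
    · rw [LinearMap.comp_apply, hxc]
      have := LinearMap.congr_fun hψ (c n j)
      rw [LinearMap.comp_apply, Submodule.subtype_apply] at this
      rw [this, Module.Basis.coord_apply, Module.Basis.repr_self, Finsupp.single_apply]
  -- the lifts are linearly independent over `A` modulo `F n`, by induction on the level of the
  -- coefficients
  have indep : ∀ n (s : Finset _) (a : _ → A), ∑ j ∈ s, a j • x n j ∈ Submodule.span A (N n : Set M)
      → ∀ j ∈ s, a j = 0 := by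
    intro n s a hsum
    have hm : ∀ m, (∀ j ∈ s, a j ∈ G m) → ∀ j ∈ s, a j = 0 := by
      intro m
      induction m with
      | zero => intro h j hj; simpa [hG0] using h j hj
      | succ m ih =>
        intro h
        refine ih fun j₀ hj₀ => ?_
        obtain ⟨φ, hφF, hφ⟩ := dual n j₀
        have := hP n m (∑ j ∈ s, a j ⊗ₜ x n j)
          (Submodule.sum_mem _ fun j hj => tmul_mem_tens (h j hj) (hxN n j))
          (by simpa [map_sum] using hsum) φ hφF
        simpa [hφ, hj₀] using this
    have hbound : ∃ m, ∀ j ∈ s, a j ∈ G m := by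
      choose e he using hGe
      exact ⟨s.sup fun j => e (a j), fun j hj => hGm (Finset.le_sup (f := fun j => e (a j)) hj)
        (he (a j))⟩
    obtain ⟨m, h⟩ := hbound
    exact hm m h
  have hspan : ∀ n, ∀ y ∈ N n, y ∈ Submodule.span A
      (X '' {p | p.1 < n}) := by
    intro n
    induction n with
    | zero => intro y hy; rw [hN0, Submodule.mem_bot] at hy; rw [hy]; exact Submodule.zero_mem _
    | succ n ih =>
      intro y hy
      have hmono : Submodule.span A (X '' {p | p.1 < n}) ≤
          Submodule.span A (X '' {p | p.1 < n + 1}) :=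
        Submodule.span_mono (Set.image_mono fun p hp => Nat.lt_succ_of_lt hp)
      have hF : ∀ y ∈ F n, y ∈ Submodule.span A
          (X '' {p | p.1 < n + 1}) := by
        intro y hy
        exact hmono ((Submodule.span_le.2 ih) hy)
      let y' : (N (n + 1)).map (F n).mkQ := ⟨(F n).mkQ y, y, hy, rfl⟩
      have hrepr := (c n).linearCombination_repr y'
      rw [Finsupp.linearCombination_apply, Finsupp.sum] at hrepr
      have hdiff : y - ∑ j ∈ ((c n).repr y').support, (c n).repr y' j • x n j ∈ F n := by
        rw [← Submodule.Quotient.mk_eq_zero, ← Submodule.mkQ_apply, map_sub, map_sum, sub_eq_zero]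
        simp only [map_smul, hxc]
        exact (congrArg Subtype.val hrepr).symm.trans (by simp)
      have := Submodule.add_mem _ (hF _ hdiff) (Submodule.sum_mem
        (Submodule.span A (X '' {p | p.1 < n + 1}))
        (t := ((c n).repr y').support) (f := fun j => (c n).repr y' j • x n j) fun j _ => ?_)
      · rwa [sub_add_cancel] at this
      · refine Submodule.smul_of_tower_mem _ _ (Submodule.subset_span ⟨⟨n, j⟩, ?_, rfl⟩)
        exact Nat.lt_succ_self n
  have hli : LinearIndependent A X := by
    rw [linearIndependent_iff]
    intro f hf
    by_contra hne
    have hnon : f.splitSupport.Nonempty := by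
      rw [Finset.nonempty_iff_ne_empty]
      intro h
      refine hne (Finsupp.ext fun p => ?_)
      have : p.1 ∉ f.splitSupport := by simp [h]
      rw [Finsupp.mem_splitSupport_iff_nonzero, not_not] at this
      have := DFunLike.congr_fun this p.2
      rwa [Finsupp.split_apply] at this
    -- the terms of maximal degree form a combination that lies in `F n`
    set n := f.splitSupport.max' hnon with hn
    have hnmem := f.splitSupport.max'_mem hnon
    rw [Finsupp.linearCombination_apply, Finsupp.sigma_sum, ← Finset.add_sum_erase _ _ hnmem] at hf
    have hlow : ∑ i ∈ f.splitSupport.erase n, (f.split i).sum (fun j a => a • x i j) ∈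
        Submodule.span A (N n : Set M) := by
      refine Submodule.sum_mem _ fun i hi => Submodule.sum_mem _ fun j _ =>
        Submodule.smul_mem _ _ (Submodule.subset_span ?_)
      have hlt : i < n := lt_of_le_of_ne
        (Finset.le_max' _ _ (Finset.mem_of_mem_erase hi)) (Finset.ne_of_mem_erase hi)
      exact hNm hlt (hxN i j)
    have htop : (f.split n).sum (fun j a => a • x n j) ∈ Submodule.span A (N n : Set M) := by
      rw [eq_neg_of_add_eq_zero_left hf]
      exact Submodule.neg_mem _ hlow
    have hzero := indep n _ _ htop
    rw [Finsupp.mem_splitSupport_iff_nonzero] at hnmem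
    refine hnmem (Finsupp.ext fun j => ?_)
    by_contra hj
    exact hj (hzero j (Finsupp.mem_support_iff.2 hj))
  refine ⟨_, Module.Basis.mk hli ?_, fun p => p.1, fun p => ?_, fun n y hy => ?_⟩
  · intro y _
    obtain ⟨n, hy⟩ := hNe y
    exact Submodule.span_mono (Set.image_subset_range _ _) (hspan n y hy)
  · rw [Module.Basis.mk_apply]
    exact hxN _ _
  · rw [Module.Basis.coe_mk]
    exact hspan n y hy

end FilteredBasis

/-! ### Coinvariants and the ideals `R B⁺` -/

section Correspondence

open Coalgebra

variable {k H R : Type*} [Field k] [Ring H] [HopfAlgebra k H]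
  [Ring R] [Algebra k R] [Coalgebra k R] [Module H R] [IsScalarTower k H R]
  [YetterDrinfeldModule k H R]

lemma comul_eq_deltaL (r : R) : comul (R := k) r = 1 ⊗ₜ r + deltaL k R r := by simp [deltaL]

lemma comul_eq_deltaR (r : R) : comul (R := k) r = r ⊗ₜ 1 + deltaR k R r := by simp [deltaR]

namespace QuotientLeftModuleCoalgebra

variable (T : QuotientLeftModuleCoalgebra k H R)

/-- The kernel of `R → T` as a vector space. -/
abbrev kerK : Submodule k R := T.ker.restrictScalars k

lemma smul_mem_kerK (h : H) {x : R} (hx : x ∈ T.kerK) : h • x ∈ T.kerK :=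
  (isYDSubmodule_iff.1 T.isYD).1 h x hx

lemma mul_mem_kerK (a : R) {x : R} (hx : x ∈ T.kerK) : a * x ∈ T.kerK :=
  T.ker.smul_mem a hx

lemma counit_eq_zero {x : R} (hx : x ∈ T.kerK) : counit (R := k) x = 0 :=
  T.isCoideal.counit_eq_zero hx

lemma proj_eq_zero_iff {x : R} : T.proj x = 0 ↔ x ∈ T.kerK :=
  Submodule.Quotient.mk_eq_zero _

lemma proj_surjective : Function.Surjective T.proj := Submodule.mkQ_surjective _

lemma leftCoinvariants_eq : T.leftCoinvariants = (tens T.kerK ⊤).comap (deltaL k R) := by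
  ext r
  have hker : LinearMap.ker T.proj = T.kerK := Submodule.ker_mkQ _
  rw [Submodule.mem_comap, ← hker, ← ker_rTensor, deltaL, LinearMap.sub_apply, map_sub, sub_eq_zero]
  rfl

lemma mem_leftCoinvariants {r : R} : r ∈ T.leftCoinvariants ↔ deltaL k R r ∈ tens T.kerK ⊤ := by
  rw [leftCoinvariants_eq]; rfl

/-- The right `T`-coinvariants `{r | r₁ ⊗ π(r₂) = r ⊗ π(1)}` of `R`. -/
def rightCoinvariants : Submodule k R :=
  LinearMap.eqLocus T.rightCoact ((TensorProduct.mk k R T.Quot).flip (T.proj 1))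

lemma rightCoinvariants_eq : T.rightCoinvariants = (tens ⊤ T.kerK).comap (deltaR k R) := by
  ext r
  have hker : LinearMap.ker T.proj = T.kerK := Submodule.ker_mkQ _
  rw [Submodule.mem_comap, ← hker, ← ker_lTensor, deltaR, LinearMap.sub_apply, map_sub, sub_eq_zero]
  rfl

lemma mem_rightCoinvariants {r : R} : r ∈ T.rightCoinvariants ↔ deltaR k R r ∈ tens ⊤ T.kerK := by
  rw [rightCoinvariants_eq]; rfl

end QuotientLeftModuleCoalgebra

variable [YDHopfAlgebra k H R]

/-- If `H • a ⊆ U` and `H • x ⊆ V`, then `H • (a x) ⊆ U V`. -/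
lemma smul_mul_mem_of_forall {U V W : Submodule k R} {a x : R} (ha : ∀ h : H, h • a ∈ U)
    (hx : ∀ h : H, h • x ∈ V) (hUV : ∀ u ∈ U, ∀ v ∈ V, u * v ∈ W) (h : H) : h • (a * x) ∈ W := by
  have h1 : h • (a * x) = LinearMap.mul' k R (diagActMap k H R R (h ⊗ₜ (a ⊗ₜ x))) :=
    LinearMap.congr_fun (YDHopfAlgebra.act_mul (k := k) (H := H) (R := R)) (h ⊗ₜ (a ⊗ₜ x))
  rw [h1, diagActMap_tmul]
  refine tens_induction (U := ⊤) (V := ⊤) (LinearMap.mul' k R ∘ₗ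
    TensorProduct.map (orbitMap k H a) (orbitMap k H x)) W
    (fun p _ q _ => hUV _ (ha p) _ (hx q)) ?_
  rw [tens_top_top]
  exact Submodule.mem_top

lemma braidedMul_tmul_one_mem {n : ℕ} {z : R ⊗[k] R} (hz : z ∈ tens ⊤ (F k H R n)) (c : R) :
    braidedMul k H R (z ⊗ₜ (c ⊗ₜ 1)) ∈ tens ⊤ (F k H R n) := by
  refine braidedMul_mem (U' := ⊤) (V' := k ∙ (1 : R)) (isYDSubmodule_iff.1 (isYDSubmodule_F n)).2
    (fun _ _ _ _ _ => Submodule.mem_top) (fun a ha j hj => ?_) hz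
    (tmul_mem_tens Submodule.mem_top (Submodule.mem_span_singleton_self _))
  obtain ⟨x, rfl⟩ := Submodule.mem_span_singleton.1 hj
  rw [mul_smul_comm, mul_one]
  exact Submodule.smul_mem _ _ ha

namespace QuotientLeftModuleCoalgebra

variable (T : QuotientLeftModuleCoalgebra k H R)

/-- Right multiplication by left coinvariants is left `T`-colinear. -/
lemma comul_mul_sub_mem {b : R} (hb : b ∈ T.leftCoinvariants) (r : R) :
    comul (R := k) (r * b) - (LinearMap.mulRight k b).lTensor R (comul (R := k) r) ∈
      tens T.kerK ⊤ := by
  rw [comul_mul (H := H), comul_eq_deltaL b, TensorProduct.tmul_add, map_add, braidedMul_one_tmul,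
    add_sub_cancel_left]
  refine braidedMul_mem (U := ⊤) (V := ⊤) (fun s => coact_mem_top)
    (fun a _ h c hc => T.mul_mem_kerK a (T.smul_mem_kerK h hc))
    (fun _ _ _ _ => Submodule.mem_top) ?_
    (T.mem_leftCoinvariants.1 hb)
  rw [tens_top_top]; trivial

/-- Up to terms of lower degree in `r` and terms that vanish in `T ⊗ R`, the comultiplication of the
product of `r` and a left coinvariant `b` is `r ⊗ b`. -/
lemma comul_mul_sub_tmul_mem {b : R} (hb : b ∈ T.leftCoinvariants) {n : ℕ} {r : R}
    (hr : r ∈ F k H R (n + 1)) :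
    comul (R := k) (r * b) - r ⊗ₜ b ∈ tens (F k H R n) ⊤ ⊔ tens T.kerK ⊤ := by
  have h1 := T.comul_mul_sub_mem hb r
  rw [comul_eq_deltaR r, map_add, LinearMap.lTensor_tmul, LinearMap.mulRight_apply, one_mul] at h1
  rw [F_succ_eq'] at hr
  have h2 : (LinearMap.mulRight k b).lTensor R (deltaR k R r) ∈ tens (F k H R n) ⊤ :=
    tens_induction _ _ (fun u hu v _ => tmul_mem_tens hu Submodule.mem_top) hr
  have := Submodule.add_mem_sup h2 h1
  convert this using 1
  abel

lemma mul_mem_leftCoinvariants {r b : R} (hr : r ∈ T.leftCoinvariants)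
    (hb : b ∈ T.leftCoinvariants) : r * b ∈ T.leftCoinvariants := by
  have h1 := T.comul_mul_sub_mem hb r
  rw [mem_leftCoinvariants] at hr ⊢
  have h2 : (LinearMap.mulRight k b).lTensor R (deltaL k R r) ∈ tens T.kerK ⊤ :=
    tens_induction _ _ (fun u hu v _ => tmul_mem_tens hu Submodule.mem_top) hr
  rw [comul_eq_deltaL r, map_add, comul_eq_deltaL (r * b)] at h1
  have := Submodule.add_mem _ h1 h2
  convert this using 1
  simp

lemma one_mem_leftCoinvariants : (1 : R) ∈ T.leftCoinvariants := by
  rw [mem_leftCoinvariants, deltaL, LinearMap.sub_apply, comul_one' k H, TensorProduct.mk_apply,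
    sub_self]
  exact Submodule.zero_mem _

lemma isYDSubmodule_leftCoinvariants : IsYDSubmodule H T.leftCoinvariants := by
  rw [leftCoinvariants_eq]
  exact isYDSubmodule_comap_deltaL T.isYD isYDSubmodule_top

lemma isYDSubmodule_rightCoinvariants : IsYDSubmodule H T.rightCoinvariants := by
  rw [rightCoinvariants_eq]
  exact isYDSubmodule_comap_deltaR isYDSubmodule_top T.isYD

omit [YDHopfAlgebra k H R] in
lemma comul_mem_leftCoinvariants {r : R} (hr : r ∈ T.leftCoinvariants) :
    comul (R := k) r ∈ tens T.leftCoinvariants ⊤ := by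
  rw [mem_leftCoinvariants, mem_tens_top_right] at hr
  rw [mem_tens_top_right]
  intro f
  rw [mem_leftCoinvariants, mem_tens_top_right]
  intro g
  obtain ⟨f, rfl⟩ := WithConv.ofConv_surjective f
  obtain ⟨g, rfl⟩ := WithConv.ofConv_surjective g
  have := hr (g * f).ofConv
  simp only [deltaL, LinearMap.sub_apply, map_sub, TensorProduct.mk_apply, rslice_tmul] at this ⊢
  rwa [rslice_comul_rslice_comul, ← conv_apply_right]

/-- The right coideal subalgebra of left `T`-coinvariants. -/
def coinvariantSubalgebra : RightCoidealSubalgebra k H R where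
  alg :=
    { T.leftCoinvariants with
      mul_mem' := T.mul_mem_leftCoinvariants
      one_mem' := T.one_mem_leftCoinvariants
      algebraMap_mem' := fun c => by
        rw [Algebra.algebraMap_eq_smul_one]
        exact T.leftCoinvariants.smul_mem c T.one_mem_leftCoinvariants }
  isYD := T.isYDSubmodule_leftCoinvariants
  comul_mem := fun x hx => by
    rw [range_rTensor_subtype]
    exact T.comul_mem_leftCoinvariants hx

/-- Up to terms of lower degree and terms that vanish in `R ⊗ T`, the comultiplication of the
product of `r` and a right coinvariant `c` is the braiding of `r ⊗ c`. -/
lemma comul_mul_sub_braiding_mem {c : R} (hc : c ∈ T.rightCoinvariants) {n : ℕ} {r : R}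
    (hr : r ∈ F k H R (n + 1)) :
    comul (R := k) (r * c) - braiding k H R R (r ⊗ₜ c) ∈ tens ⊤ (F k H R n) ⊔ tens ⊤ T.kerK := by
  rw [F_succ_eq] at hr
  have h1 : braidedMul k H R (comul (R := k) r ⊗ₜ deltaR k R c) ∈ tens ⊤ T.kerK := by
    refine braidedMul_mem (U := ⊤) (V := ⊤) (U' := ⊤) (fun s => coact_mem_top)
      (fun _ _ _ _ _ => Submodule.mem_top) (fun a _ j hj => T.mul_mem_kerK a hj) ?_
      (T.mem_rightCoinvariants.1 hc)
    rw [tens_top_top]; trivial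
  have h2 : braidedMul k H R (deltaL k R r ⊗ₜ (c ⊗ₜ 1)) ∈ tens ⊤ (F k H R n) :=
    braidedMul_tmul_one_mem hr c
  have := Submodule.add_mem_sup h2 h1
  convert this using 1
  rw [comul_mul (H := H), comul_eq_deltaR c, TensorProduct.tmul_add, map_add, ← braidedMul_one_one]
  conv_lhs => rw [comul_eq_deltaL r]
  conv_rhs => rw [comul_eq_deltaL r]
  simp only [TensorProduct.add_tmul, map_add]
  abel

end QuotientLeftModuleCoalgebra

namespace RightCoidealSubalgebra

variable (B : RightCoidealSubalgebra k H R)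

/-- The left ideal `R B⁺` as a vector space. -/
abbrev leftIdealK : Submodule k R := B.leftIdeal.restrictScalars k

omit [YDHopfAlgebra k H R] in
lemma comul_mem_tens {b : R} (hb : b ∈ B.alg) :
    comul (R := k) b ∈ tens (Subalgebra.toSubmodule B.alg) ⊤ := by
  rw [← range_rTensor_subtype]
  exact B.comul_mem b hb

omit [YDHopfAlgebra k H R] in
lemma smul_mem_alg (h : H) {b : R} (hb : b ∈ B.alg) : h • b ∈ B.alg :=
  B.isYD.smul_mem h b hb

omit [YDHopfAlgebra k H R] in
lemma mem_leftIdeal {b : R} (hb : b ∈ B.alg) (h : counit (R := k) b = 0) : b ∈ B.leftIdeal :=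
  Submodule.subset_span ⟨hb, h⟩

lemma deltaL_mem {b : R} (hb : b ∈ B.alg) : deltaL k R b ∈ tens B.leftIdealK ⊤ := by
  rw [mem_tens_top_right]
  intro f
  obtain ⟨f, rfl⟩ := WithConv.ofConv_surjective f
  have h1 := mem_tens_top_right.1 (B.comul_mem_tens hb) f.ofConv
  rw [deltaL, LinearMap.sub_apply, map_sub, TensorProduct.mk_apply, rslice_tmul]
  refine B.mem_leftIdeal (sub_mem h1 (B.alg.smul_mem B.alg.one_mem _)) ?_
  have h2 := conv_apply_right (WithConv.toConv (counit (R := k))) f b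
  rw [conv_apply_left] at h2
  change f (lslice (counit (R := k)) (comul b)) = counit (R := k) (rslice f.ofConv (comul b)) at h2
  rw [map_sub, ← h2, lslice_counit_comul, map_smul, counit_one' k H, smul_eq_mul, mul_one, sub_self]

lemma isYDSubmodule_leftIdeal : IsYDSubmodule H B.leftIdealK := by
  rw [isYDSubmodule_iff]
  constructor
  · intro h x hx
    revert h
    refine Submodule.span_induction ?_ ?_ ?_ ?_ (hx : x ∈ B.leftIdeal)
    · rintro b ⟨hb, hε⟩ h
      refine B.mem_leftIdeal (B.smul_mem_alg h hb) ?_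
      rw [YDHopfAlgebra.counit_smul (k := k), hε, mul_zero]
    · intro h; rw [smul_zero]; exact Submodule.zero_mem _
    · intro x y _ _ hx hy h; rw [smul_add]; exact Submodule.add_mem _ (hx h) (hy h)
    · intro a x _ hx h
      exact smul_mul_mem_of_forall (U := ⊤) (fun _ => Submodule.mem_top) hx
        (fun u _ v hv => B.leftIdeal.smul_mem u hv) h
  · intro x hx
    refine Submodule.span_induction ?_ ?_ ?_ ?_ (hx : x ∈ B.leftIdeal)
    · rintro b ⟨hb, hε⟩
      have h1 := (isYDSubmodule_iff.1 B.isYD).2 b hb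
      rw [mem_tens_top_left] at h1 ⊢
      intro f
      refine B.mem_leftIdeal (h1 f) ?_
      rw [← lslice_lTensor, YDHopfAlgebra.counit_coact, hε, TensorProduct.tmul_zero, map_zero]
    · rw [map_zero]; exact Submodule.zero_mem _
    · intro x y _ _ hx hy; rw [map_add]; exact Submodule.add_mem _ hx hy
    · intro a x _ hx
      have h1 := LinearMap.congr_fun (YDHopfAlgebra.coact_mul (k := k) (H := H) (R := R)) (a ⊗ₜ x)
      change coact k H R (a * x) =
        (LinearMap.mul' k R).lTensor H (codiagCoact k H R R (a ⊗ₜ x)) at h1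
      rw [smul_eq_mul, h1]
      have h2 := codiagCoact_mem (H := H) (U := ⊤) (U' := ⊤) (V := k ∙ x) (V' := B.leftIdealK)
        (fun s hs => coact_mem_top hs) (fun v hv => by
          obtain ⟨c, rfl⟩ := Submodule.mem_span_singleton.1 hv
          rw [map_smul]
          exact Submodule.smul_mem _ _ hx)
        (tmul_mem_tens (u := a) Submodule.mem_top (Submodule.mem_span_singleton_self x))
      refine tens_induction _ _ (fun h _ z hz => tmul_mem_tens Submodule.mem_top ?_) h2
      exact tens_induction (LinearMap.mul' k R) B.leftIdealK
        (fun u _ v hv => B.leftIdeal.smul_mem u hv) hz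

lemma isCoideal_leftIdeal : B.leftIdealK.IsCoideal := by
  rw [Submodule.isCoideal_iff_comul_mem, range_lTensor_subtype, range_rTensor_subtype]
  constructor
  · intro x hx
    refine Submodule.span_induction (fun b hb => hb.2) (map_zero _) ?_ ?_ (hx : x ∈ B.leftIdeal)
    · intro x y _ _ hx hy; rw [map_add, hx, hy, add_zero]
    · intro a x _ hx
      rw [smul_eq_mul, YDHopfAlgebra.counit_mul (H := H), hx, mul_zero]
  · intro x hx
    refine Submodule.span_induction ?_ ?_ ?_ ?_ (hx : x ∈ B.leftIdeal)
    · rintro b ⟨hb, hε⟩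
      rw [comul_eq_deltaL]
      exact Submodule.add_mem_sup (tmul_mem_tens Submodule.mem_top (B.mem_leftIdeal hb hε))
        (B.deltaL_mem hb)
    · rw [map_zero]; exact Submodule.zero_mem _
    · intro x y _ _ hx hy; rw [map_add]; exact Submodule.add_mem _ hx hy
    · intro a x _ hx
      rw [smul_eq_mul, comul_mul (H := H)]
      obtain ⟨y, hy, z, hz, hyz⟩ := Submodule.mem_sup.1 hx
      rw [← hyz, TensorProduct.tmul_add, map_add]
      have ha : comul (R := k) a ∈ tens (⊤ : Submodule k R) (⊤ : Submodule k R) := by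
        rw [tens_top_top]; trivial
      refine Submodule.add_mem_sup ?_ ?_
      · exact braidedMul_mem (fun s => coact_mem_top) (fun _ _ _ _ _ => Submodule.mem_top)
          (fun u _ v hv => B.leftIdeal.smul_mem u hv) ha hy
      · exact braidedMul_mem (fun s => coact_mem_top)
          (fun u _ h v hv => B.leftIdeal.smul_mem u
            ((isYDSubmodule_iff.1 B.isYDSubmodule_leftIdeal).1 h v hv))
          (fun _ _ _ _ => Submodule.mem_top) ha hz

/-- The quotient left module coalgebra `R / R B⁺`. -/
def quotientCoalgebra : QuotientLeftModuleCoalgebra k H R where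
  ker := B.leftIdeal
  isYD := B.isYDSubmodule_leftIdeal
  isCoideal := B.isCoideal_leftIdeal

lemma le_leftCoinvariants : Subalgebra.toSubmodule B.alg ≤ B.quotientCoalgebra.leftCoinvariants :=
  fun _ hb => B.quotientCoalgebra.mem_leftCoinvariants.2 (B.deltaL_mem hb)

end RightCoidealSubalgebra

end Correspondence

/-! ### Cofreeness over quotient module coalgebras -/

section Cofree

open Coalgebra

variable {k H R : Type*} [Field k] [Ring H] [HopfAlgebra k H]
  [Ring R] [Algebra k R] [Coalgebra k R] [Module H R] [IsScalarTower k H R]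
  [YetterDrinfeldModule k H R]

namespace QuotientLeftModuleCoalgebra

variable (T : QuotientLeftModuleCoalgebra k H R) {V : Type*} [AddCommGroup V] [Module k V]

/-- The map `R → T ⊗ V`, `r ↦ π(r₁) ⊗ q(r₂)`. -/
def leftMap (q : R →ₗ[k] V) : R →ₗ[k] T.Quot ⊗[k] V := q.lTensor T.Quot ∘ₗ T.leftCoact

/-- The map `R → V ⊗ T`, `r ↦ q(r₁) ⊗ π(r₂)`. -/
def rightMap (q : R →ₗ[k] V) : R →ₗ[k] V ⊗[k] T.Quot := q.rTensor T.Quot ∘ₗ T.rightCoact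

lemma leftMap_apply (q : R →ₗ[k] V) (r : R) :
    T.leftMap q r = TensorProduct.map T.proj q (comul (R := k) r) := by
  simp only [leftMap, leftCoact, LinearMap.comp_apply, LinearMap.lTensor, LinearMap.rTensor,
    TensorProduct.map_map]
  rfl

lemma rightMap_apply (q : R →ₗ[k] V) (r : R) :
    T.rightMap q r = TensorProduct.map q T.proj (comul (R := k) r) := by
  simp only [rightMap, rightCoact, LinearMap.comp_apply, LinearMap.lTensor, LinearMap.rTensor,
    TensorProduct.map_map]
  rfl

lemma comul_proj (r : R) : comul (R := k) (T.proj r) =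
    TensorProduct.map T.proj T.proj (comul (R := k) r) := rfl

lemma counit_proj (r : R) : counit (R := k) (T.proj r) = counit (R := k) r := rfl

lemma lTensor_leftMap_comp_leftCoact (q : R →ₗ[k] V) :
    (T.leftMap q).lTensor T.Quot ∘ₗ T.leftCoact =
      (TensorProduct.assoc k T.Quot T.Quot V).toLinearMap ∘ₗ
        (comul (R := k) (A := T.Quot)).rTensor V ∘ₗ T.leftMap q := by
  ext r
  simp only [LinearMap.comp_apply, leftMap_apply, leftCoact, LinearEquiv.coe_coe]
  trans TensorProduct.map T.proj (TensorProduct.map T.proj q)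
    ((comul (R := k)).lTensor R (comul (R := k) r))
  · generalize comul (R := k) r = z
    induction z with
    | zero => simp
    | tmul a b => simp [leftMap_apply]
    | add x y hx hy => simp only [map_add, hx, hy]
  · rw [← Coalgebra.coassoc_apply]
    generalize comul (R := k) r = z
    induction z with
    | zero => simp
    | add x y hx hy => simp only [map_add, hx, hy]
    | tmul a b =>
      rw [TensorProduct.map_tmul, LinearMap.rTensor_tmul, LinearMap.rTensor_tmul, comul_proj]
      generalize comul (R := k) a = z
      induction z with
      | zero => simp
      | tmul a b => simp
      | add x y hx hy => simp only [map_add, hx, hy, TensorProduct.add_tmul]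

lemma rTensor_rightMap_comp_rightCoact (q : R →ₗ[k] V) :
    (T.rightMap q).rTensor T.Quot ∘ₗ T.rightCoact =
      (TensorProduct.assoc k V T.Quot T.Quot).symm.toLinearMap ∘ₗ
        (comul (R := k) (A := T.Quot)).lTensor V ∘ₗ T.rightMap q := by
  ext r
  simp only [LinearMap.comp_apply, rightMap_apply, rightCoact, LinearEquiv.coe_coe]
  trans TensorProduct.map (TensorProduct.map q T.proj) T.proj
    ((comul (R := k)).rTensor R (comul (R := k) r))
  · generalize comul (R := k) r = z
    induction z with
    | zero => simp
    | tmul a b => simp [rightMap_apply]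
    | add x y hx hy => simp only [map_add, hx, hy]
  · rw [← Coalgebra.coassoc_symm_apply]
    generalize comul (R := k) r = z
    induction z with
    | zero => simp
    | add x y hx hy => simp only [map_add, hx, hy]
    | tmul a b =>
      rw [TensorProduct.map_tmul, LinearMap.lTensor_tmul, LinearMap.lTensor_tmul, comul_proj]
      generalize comul (R := k) b = z
      induction z with
      | zero => simp
      | tmul a b => simp
      | add x y hx hy => simp only [map_add, hx, hy, TensorProduct.tmul_add]

variable [YDHopfAlgebra k H R]

/-- A left colinear map `r ↦ π(r₁) ⊗ q(r₂)` is injective if `q` is injective on coinvariants: its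
kernel is a subcomodule without nonzero coinvariants, and `R` is connected. -/
lemma leftMap_injective (hR : IsConnected k R) (q : R →ₗ[k] V)
    (hq : ∀ r ∈ T.leftCoinvariants, q r = 0 → r = 0) : Function.Injective (T.leftMap q) := by
  rw [injective_iff_map_eq_zero]
  have key : ∀ n, ∀ r ∈ F k H R n, T.leftMap q r = 0 → r = 0 := by
    intro n
    induction n with
    | zero => intro r hr _; rwa [F_zero, Submodule.mem_bot] at hr
    | succ n ih =>
      intro r hr h0
      have hcol := LinearMap.congr_fun (T.lTensor_leftMap_comp_leftCoact q) r
      simp only [LinearMap.comp_apply, h0, map_zero] at hcol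
      have hr' : T.leftCoact r = T.proj 1 ⊗ₜ r := by
        refine eq_of_lslice (k := k) fun f => ?_
        rw [lslice_tmul, ← sub_eq_zero]
        refine ih _ ?_ ?_
        · rw [F_succ_eq, Submodule.mem_comap, mem_tens_top_left] at hr
          have := hr (f ∘ₗ T.proj)
          rwa [deltaL, LinearMap.sub_apply, map_sub, TensorProduct.mk_apply, lslice_tmul,
            ← lslice_rTensor] at this
        · rw [map_sub, map_smul, h0, smul_zero, sub_zero, ← lslice_lTensor, hcol, map_zero]
      refine hq r hr' ?_
      have h1 : T.leftMap q r = T.proj 1 ⊗ₜ q r := by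
        rw [leftMap, LinearMap.comp_apply, hr', LinearMap.lTensor_tmul]
      have := congrArg (lslice (counit (R := k) (A := T.Quot))) (h1.symm.trans h0)
      rwa [lslice_tmul, counit_proj, counit_one' k H, one_smul, map_zero] at this
  intro r hr
  obtain ⟨n, hn⟩ := exists_mem_F (H := H) hR r
  exact key n r hn hr

lemma rightMap_injective (hR : IsConnected k R) (q : R →ₗ[k] V)
    (hq : ∀ r ∈ T.rightCoinvariants, q r = 0 → r = 0) : Function.Injective (T.rightMap q) := by
  rw [injective_iff_map_eq_zero]
  have key : ∀ n, ∀ r ∈ F k H R n, T.rightMap q r = 0 → r = 0 := by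
    intro n
    induction n with
    | zero => intro r hr _; rwa [F_zero, Submodule.mem_bot] at hr
    | succ n ih =>
      intro r hr h0
      have hcol := LinearMap.congr_fun (T.rTensor_rightMap_comp_rightCoact q) r
      simp only [LinearMap.comp_apply, h0, map_zero] at hcol
      have hr' : T.rightCoact r = r ⊗ₜ T.proj 1 := by
        refine eq_of_rslice (k := k) fun f => ?_
        rw [rslice_tmul, ← sub_eq_zero]
        refine ih _ ?_ ?_
        · rw [F_succ_eq', Submodule.mem_comap, mem_tens_top_right] at hr
          have := hr (f ∘ₗ T.proj)
          rwa [deltaR, LinearMap.sub_apply, map_sub, LinearMap.flip_apply, TensorProduct.mk_apply,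
            rslice_tmul, ← rslice_lTensor] at this
        · rw [map_sub, map_smul, h0, smul_zero, sub_zero, ← rslice_rTensor, hcol, map_zero]
      refine hq r hr' ?_
      have h1 : T.rightMap q r = q r ⊗ₜ T.proj 1 := by
        rw [rightMap, LinearMap.comp_apply, hr', LinearMap.rTensor_tmul]
      have := congrArg (rslice (counit (R := k) (A := T.Quot))) (h1.symm.trans h0)
      rwa [rslice_tmul, counit_proj, counit_one' k H, one_smul, map_zero] at this
  intro r hr
  obtain ⟨n, hn⟩ := exists_mem_F (H := H) hR r
  exact key n r hn hr

/-- If `q` splits the inclusion `j` of left coinvariants, then `r ↦ π(r₁) ⊗ q(r₂)` is surjective: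
the image of `r j(v)` is `π(r) ⊗ v` up to terms of lower degree in `r`. -/
lemma leftMap_surjective (hR : IsConnected k R) (q : R →ₗ[k] V) (j : V → R)
    (hj : ∀ v, j v ∈ T.leftCoinvariants) (hqj : ∀ v, q (j v) = v) :
    Function.Surjective (T.leftMap q) := by
  have key : ∀ n, ∀ r ∈ F k H R n, ∀ v, T.proj r ⊗ₜ[k] v ∈ LinearMap.range (T.leftMap q) := by
    intro n
    induction n with
    | zero =>
      intro r hr v
      rw [F_zero, Submodule.mem_bot] at hr
      rw [hr, map_zero, TensorProduct.zero_tmul]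
      exact Submodule.zero_mem _
    | succ n ih =>
      intro r hr v
      have hle : tens (F k H R n) ⊤ ⊔ tens T.kerK ⊤ ≤
          (LinearMap.range (T.leftMap q)).comap (TensorProduct.map T.proj q) := by
        refine sup_le (fun z hz => ?_) fun z hz => ?_
        · exact tens_induction (TensorProduct.map T.proj q) (LinearMap.range (T.leftMap q))
            (fun u hu w _ => ih u hu (q w)) hz
        · refine tens_induction (TensorProduct.map T.proj q) (LinearMap.range (T.leftMap q))
            (fun u hu w _ => ?_) hz
          rw [TensorProduct.map_tmul, T.proj_eq_zero_iff.2 hu, TensorProduct.zero_tmul]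
          exact Submodule.zero_mem _
      have h1 := hle (T.comul_mul_sub_tmul_mem (hj v) hr)
      rw [Submodule.mem_comap, map_sub, ← leftMap_apply, TensorProduct.map_tmul, hqj] at h1
      have := Submodule.sub_mem _ (LinearMap.mem_range_self (T.leftMap q) (r * j v)) h1
      rwa [sub_sub_cancel] at this
  rw [← LinearMap.range_eq_top, eq_top_iff, ← tens_top_top]
  refine Submodule.map₂_le.2 fun t _ v _ => ?_
  obtain ⟨r, rfl⟩ := T.proj_surjective t
  obtain ⟨n, hn⟩ := exists_mem_F (H := H) hR r
  exact key n r hn v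

/-- If `q` splits the inclusion `j` of right coinvariants, then `r ↦ q(r₁) ⊗ π(r₂)` is surjective.
Here `Δ(r j(v))` is the braiding of `r ⊗ j(v)` up to terms of lower degree in `r` and terms that
vanish in `R ⊗ T`, and the braiding is invertible because the antipode of `H` is bijective. -/
lemma rightMap_surjective
    (hH : Function.Bijective (HopfAlgebra.antipode k : H →ₗ[k] H))
    (hR : IsConnected k R) (q : R →ₗ[k] V) (j : V → R)
    (hj : ∀ v, j v ∈ T.rightCoinvariants) (hqj : ∀ v, q (j v) = v) :
    Function.Surjective (T.rightMap q) := by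
  let E := LinearEquiv.ofBijective _ hH
  let S : H →ₗ[k] H := E.symm.toLinearMap
  have hS : ∀ h, HopfAlgebra.antipode k (S h) = h := E.apply_symm_apply
  have hS' : ∀ h, S (HopfAlgebra.antipode k h) = h := E.symm_apply_apply
  have key : ∀ n, ∀ r ∈ F k H R n, ∀ v, v ⊗ₜ[k] T.proj r ∈ LinearMap.range (T.rightMap q) := by
    intro n
    induction n with
    | zero =>
      intro r hr v
      rw [F_zero, Submodule.mem_bot] at hr
      rw [hr, map_zero, TensorProduct.tmul_zero]
      exact Submodule.zero_mem _
    | succ n ih =>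
      intro r hr v
      have hle : tens ⊤ (F k H R n) ⊔ tens ⊤ T.kerK ≤
          (LinearMap.range (T.rightMap q)).comap (TensorProduct.map q T.proj) := by
        refine sup_le (fun z hz => ?_) fun z hz => ?_
        · exact tens_induction (TensorProduct.map q T.proj) (LinearMap.range (T.rightMap q))
            (fun w _ u hu => ih u hu (q w)) hz
        · refine tens_induction (TensorProduct.map q T.proj) (LinearMap.range (T.rightMap q))
            (fun w _ u hu => ?_) hz
          rw [TensorProduct.map_tmul, T.proj_eq_zero_iff.2 hu, TensorProduct.tmul_zero]
          exact Submodule.zero_mem _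
      have hy : invBraiding S (j v ⊗ₜ[k] r) ∈ tens (F k H R (n + 1)) T.rightCoinvariants :=
        invBraiding_mem S (isYDSubmodule_iff.1 T.isYDSubmodule_rightCoinvariants).1
          (isYDSubmodule_iff.1 (isYDSubmodule_F (n + 1))).2 (tmul_mem_tens (hj v) hr)
      have h1 := tens_induction (comul (R := k) ∘ₗ LinearMap.mul' k R - braiding k H R R) _
        (fun u hu c hc => T.comul_mul_sub_braiding_mem hc hu) hy
      have h2 := hle h1
      rw [Submodule.mem_comap, LinearMap.sub_apply, braiding_invBraiding hS hS', map_sub,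
        LinearMap.comp_apply, ← rightMap_apply, TensorProduct.map_tmul, hqj] at h2
      have := Submodule.sub_mem _ (LinearMap.mem_range_self (T.rightMap q)
        (LinearMap.mul' k R (invBraiding S (j v ⊗ₜ[k] r)))) h2
      rwa [sub_sub_cancel] at this
  rw [← LinearMap.range_eq_top, eq_top_iff, ← tens_top_top]
  refine Submodule.map₂_le.2 fun v _ t _ => ?_
  obtain ⟨r, rfl⟩ := T.proj_surjective t
  obtain ⟨n, hn⟩ := exists_mem_F (H := H) hR r
  exact key n r hn v

lemma leftMap_bijective (hR : IsConnected k R) (q : R →ₗ[k] V) (j : V → R)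
    (hj : ∀ r, r ∈ T.leftCoinvariants ↔ ∃ v, j v = r) (hqj : ∀ v, q (j v) = v) :
    Function.Bijective (T.leftMap q) := by
  refine ⟨T.leftMap_injective hR q fun r hr h => ?_,
    T.leftMap_surjective hR q j (fun v => (hj _).2 ⟨v, rfl⟩) hqj⟩
  obtain ⟨v, rfl⟩ := (hj r).1 hr
  obtain ⟨w, hw⟩ := (hj 0).1 (Submodule.zero_mem _)
  have hw0 : w = 0 := by rw [← hqj w, hw, map_zero]
  rw [hqj] at h
  rw [h, ← hw0, hw]

theorem isLeftCofree_leftCoact (hR : IsConnected k R) : IsLeftCofree T.leftCoact := by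
  obtain ⟨q, hq⟩ := LinearMap.exists_leftInverse_of_injective T.leftCoinvariants.subtype
    (Submodule.ker_subtype _)
  have hq' : ∀ v : T.leftCoinvariants, q v = v := LinearMap.congr_fun hq
  exact ⟨T.leftCoinvariants, inferInstance, inferInstance,
    LinearEquiv.ofBijective (T.leftMap q) (T.leftMap_bijective hR q Subtype.val
      (fun r => ⟨fun h => ⟨⟨r, h⟩, rfl⟩, fun ⟨v, hv⟩ => hv ▸ v.2⟩) hq'),
    T.lTensor_leftMap_comp_leftCoact q⟩

theorem isRightCofree_rightCoact (hH : Function.Bijective (HopfAlgebra.antipode k : H →ₗ[k] H))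
    (hR : IsConnected k R) : IsRightCofree T.rightCoact := by
  obtain ⟨q, hq⟩ := LinearMap.exists_leftInverse_of_injective T.rightCoinvariants.subtype
    (Submodule.ker_subtype _)
  have hq' : ∀ v : T.rightCoinvariants, q v = v := LinearMap.congr_fun hq
  refine ⟨T.rightCoinvariants, inferInstance, inferInstance,
    LinearEquiv.ofBijective (T.rightMap q) ⟨T.rightMap_injective hR q fun r hr h => ?_,
      T.rightMap_surjective hH hR q Subtype.val (fun v => v.2) hq'⟩,
    T.rTensor_rightMap_comp_rightCoact q⟩
  have := hq' ⟨r, hr⟩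
  rw [h] at this
  exact (congrArg Subtype.val this).symm

end QuotientLeftModuleCoalgebra

end Cofree

/-! ### Freeness over right coideal subalgebras -/

section Freeness

open Coalgebra

universe v

variable {k H : Type*} {R : Type v} [Field k] [Ring H] [HopfAlgebra k H]
  [Ring R] [Algebra k R] [Coalgebra k R] [Module H R] [IsScalarTower k H R]
  [YetterDrinfeldModule k H R] [YDHopfAlgebra k H R]

namespace RightCoidealSubalgebra

variable (B : RightCoidealSubalgebra k H R)

lemma comul_mem_tens_F {n : ℕ} {x : R} (hx : x ∈ F k H R n) :
    comul (R := k) x ∈ tens (F k H R n) ⊤ := by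
  have h := F_mono (k := k) (H := H) (R := R) (Nat.le_succ n) hx
  rw [Nat.succ_eq_add_one, F_succ_eq'] at h
  rw [comul_eq_deltaR]
  exact Submodule.add_mem _ (tmul_mem_tens hx Submodule.mem_top) h

/-- The right `B`-submodule `F n B` of `R`. -/
abbrev rightSpan (n : ℕ) : Submodule k R :=
  (Submodule.span B.alg.op (F k H R n : Set R)).restrictScalars k

/-- The left `B`-submodule `B (F n)` of `R`. -/
abbrev leftSpan (n : ℕ) : Submodule k R :=
  (Submodule.span B.alg (F k H R n : Set R)).restrictScalars k

lemma F_le_rightSpan (n : ℕ) : F k H R n ≤ B.rightSpan n := fun _ hx =>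
  Submodule.subset_span (R := B.alg.op) hx

lemma F_le_leftSpan (n : ℕ) : F k H R n ≤ B.leftSpan n := fun _ hx =>
  Submodule.subset_span (R := B.alg) hx

lemma mul_mem_rightSpan {n : ℕ} {x b : R} (hx : x ∈ B.rightSpan n) (hb : b ∈ B.alg) :
    x * b ∈ B.rightSpan n :=
  (Submodule.span B.alg.op (F k H R n : Set R)).smul_mem ⟨MulOpposite.op b, hb⟩ hx

lemma mul_mem_leftSpan {n : ℕ} {x b : R} (hx : x ∈ B.leftSpan n) (hb : b ∈ B.alg) :
    b * x ∈ B.leftSpan n :=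
  (Submodule.span B.alg (F k H R n : Set R)).smul_mem ⟨b, hb⟩ hx

lemma comul_mem_rightSpan {n : ℕ} {x : R} (hx : x ∈ B.rightSpan n) :
    comul (R := k) x ∈ tens (B.rightSpan n) ⊤ := by
  refine Submodule.span_induction ?_ ?_ ?_ ?_ (hx : x ∈ Submodule.span B.alg.op (F k H R n : Set R))
  · exact fun x hx => tens_mono (B.F_le_rightSpan n) le_rfl (comul_mem_tens_F hx)
  · rw [map_zero]; exact Submodule.zero_mem _
  · intro x y _ _ hx hy; rw [map_add]; exact Submodule.add_mem _ hx hy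
  · intro a x _ hx
    change comul (R := k) (x * a.1.unop) ∈ _
    rw [comul_mul (H := H)]
    exact braidedMul_mem (fun _ => coact_mem_top)
      (fun u hu h c hc => B.mul_mem_rightSpan hu (B.smul_mem_alg h hc))
      (fun _ _ _ _ => Submodule.mem_top) hx (B.comul_mem_tens a.2)

lemma smul_mem_leftSpan {n : ℕ} (h : H) {x : R} (hx : x ∈ B.leftSpan n) :
    h • x ∈ B.leftSpan n := by
  revert h
  refine Submodule.span_induction ?_ ?_ ?_ ?_ (hx : x ∈ Submodule.span B.alg (F k H R n : Set R))
  · exact fun x hx h => Submodule.subset_span ((isYDSubmodule_F n).smul_mem h x hx)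
  · intro h; rw [smul_zero]; exact Submodule.zero_mem _
  · intro x y _ _ hx hy h; rw [smul_add]; exact Submodule.add_mem _ (hx h) (hy h)
  · intro a x _ hx h
    exact smul_mul_mem_of_forall (U := Subalgebra.toSubmodule B.alg)
      (fun h => B.smul_mem_alg h a.2) hx (fun u hu v hv => B.mul_mem_leftSpan hv hu) h

lemma comul_mem_leftSpan {n : ℕ} {x : R} (hx : x ∈ B.leftSpan n) :
    comul (R := k) x ∈ tens (B.leftSpan n) ⊤ := by
  refine Submodule.span_induction ?_ ?_ ?_ ?_ (hx : x ∈ Submodule.span B.alg (F k H R n : Set R))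
  · exact fun x hx => tens_mono (B.F_le_leftSpan n) le_rfl (comul_mem_tens_F hx)
  · rw [map_zero]; exact Submodule.zero_mem _
  · intro x y _ _ hx hy; rw [map_add]; exact Submodule.add_mem _ hx hy
  · intro a x _ hx
    change comul (R := k) ((a : R) * x) ∈ _
    rw [comul_mul (H := H)]
    exact braidedMul_mem (fun _ => coact_mem_top)
      (fun u hu h c hc => B.mul_mem_leftSpan (B.smul_mem_leftSpan h hc) hu)
      (fun _ _ _ _ => Submodule.mem_top) (B.comul_mem_tens a.2) hx

/-- Up to terms of lower degree in `x` or in `b`, the comultiplication of `x b` is `x ⊗ b`. -/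
lemma comul_mul_sub_tmul_mem {n m : ℕ} {x b : R} (hx : x ∈ F k H R (n + 1)) (hb : b ∈ B.alg)
    (hbm : b ∈ F k H R (m + 1)) :
    comul (R := k) (x * b) - x ⊗ₜ b ∈ tens (B.rightSpan n) ⊤ ⊔ tens ⊤ (F k H R m) := by
  rw [F_succ_eq'] at hx
  rw [F_succ_eq] at hbm
  have h1 : braidedMul k H R (deltaR k R x ⊗ₜ comul (R := k) b) ∈ tens (B.rightSpan n) ⊤ :=
    braidedMul_mem (fun _ => coact_mem_top)
      (fun u hu h c hc => B.mul_mem_rightSpan (B.F_le_rightSpan n hu) (B.smul_mem_alg h hc))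
      (fun _ _ _ _ => Submodule.mem_top) hx (B.comul_mem_tens hb)
  have h2 : (LinearMap.mulLeft k x).rTensor R (deltaL k R b) ∈ tens ⊤ (F k H R m) :=
    tens_induction _ _ (fun u _ v hv => tmul_mem_tens Submodule.mem_top hv) hbm
  have := Submodule.add_mem_sup h1 h2
  convert this using 1
  rw [comul_mul (H := H)]
  nth_rw 1 [comul_eq_deltaR x]
  rw [TensorProduct.add_tmul, map_add, braidedMul_tmul_one]
  nth_rw 1 [comul_eq_deltaL b]
  simp only [map_add, LinearMap.rTensor_tmul, LinearMap.mulLeft_apply, mul_one]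
  abel

/-- Up to terms of lower degree in `x` or in `b`, the comultiplication of `b x` is the braiding of
`b ⊗ x`. -/
lemma comul_mul_sub_braiding_mem {n m : ℕ} {x b : R} (hx : x ∈ F k H R (n + 1)) (hb : b ∈ B.alg)
    (hbm : b ∈ F k H R (m + 1)) :
    comul (R := k) (b * x) - braiding k H R R (b ⊗ₜ x) ∈
      tens (B.leftSpan n) ⊤ ⊔ tens ⊤ (F k H R m) := by
  rw [F_succ_eq'] at hx
  rw [F_succ_eq] at hbm
  have h1 : braidedMul k H R (comul (R := k) b ⊗ₜ deltaR k R x) ∈ tens (B.leftSpan n) ⊤ :=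
    braidedMul_mem (fun _ => coact_mem_top)
      (fun u hu h c hc => B.mul_mem_leftSpan
        (B.F_le_leftSpan n ((isYDSubmodule_F n).smul_mem h c hc)) hu)
      (fun _ _ _ _ => Submodule.mem_top) (B.comul_mem_tens hb) hx
  have h2 : braidedMul k H R (deltaL k R b ⊗ₜ (x ⊗ₜ 1)) ∈ tens ⊤ (F k H R m) :=
    braidedMul_tmul_one_mem hbm x
  have := Submodule.add_mem_sup h1 h2
  convert this using 1
  rw [comul_mul (H := H), comul_eq_deltaR x, TensorProduct.tmul_add, map_add, ← braidedMul_one_one]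
  nth_rw 1 [comul_eq_deltaL b]
  simp only [TensorProduct.add_tmul, map_add]
  abel

/-- `R` has a right `B`-basis adapted to the coradical filtration. -/
lemma exists_right_basis (hR : IsConnected k R) :
    ∃ (ι : Type v) (b : Module.Basis ι B.alg.op R) (deg : ι → ℕ),
      (∀ i, b i ∈ F k H R (deg i + 1)) ∧
        ∀ n, ∀ x ∈ F k H R n, x ∈ Submodule.span B.alg.op (b '' {i | deg i < n}) := by
  -- the inclusion of `Bᵒᵖ` into `R`
  let u : B.alg.op →ₗ[k] R :=
    (MulOpposite.opLinearEquiv k).symm.toLinearMap ∘ₗ B.alg.op.val.toLinearMap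
  have hu : Function.Injective u := fun a b h => Subtype.ext (MulOpposite.unop_injective h)
  refine exists_filtered_basis (F k H R) F_zero F_mono (exists_mem_F hR)
    (fun m => (F k H R m).comap u) ?_ (fun m n h => Submodule.comap_mono (F_mono h))
    (fun a => exists_mem_F (H := H) hR (u a)) fun n m z hz hsum φ hφ => ?_
  · rw [F_zero]
    exact LinearMap.ker_eq_bot.2 hu
  · have h1 := tens_induction ((comul (R := k)) ∘ₗ
      (TensorProduct.lift (Algebra.lsmul k k R : B.alg.op →ₐ[k] Module.End k R).toLinearMap) -
      (TensorProduct.comm k R R).toLinearMap ∘ₗ u.rTensor R)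
      (tens (B.rightSpan n) ⊤ ⊔ tens ⊤ (F k H R m))
      (fun a ha x hx => B.comul_mul_sub_tmul_mem hx a.2 ha) hz
    have h2 : lslice φ (TensorProduct.comm k R R (u.rTensor R z)) = u (rslice φ z) := by
      rw [← rslice_rTensor]
      generalize u.rTensor R z = y
      induction y with
      | zero => simp
      | tmul a b => simp
      | add x y hx hy => simp only [map_add, hx, hy]
    have h3 : ∀ y ∈ tens (B.rightSpan n) (⊤ : Submodule k R), lslice φ y = 0 := fun y hy =>
      (Submodule.mem_bot k).1 (tens_induction (lslice φ) ⊥ (fun v hv w _ => by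
        rw [lslice_tmul, hφ v hv, zero_smul]; exact Submodule.zero_mem _) hy)
    have h4 : tens (B.rightSpan n) ⊤ ⊔ tens ⊤ (F k H R m) ≤ (F k H R m).comap (lslice φ) := by
      refine sup_le (fun y hy => ?_) fun y hy => mem_tens_top_left.1 hy φ
      rw [Submodule.mem_comap, h3 y hy]
      exact Submodule.zero_mem _
    have h5 := h4 h1
    rw [Submodule.mem_comap, LinearMap.sub_apply, map_sub, LinearMap.comp_apply,
      h3 _ (B.comul_mem_rightSpan hsum), zero_sub, Submodule.neg_mem_iff] at h5
    exact Submodule.mem_comap.2 (h2 ▸ h5)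

/-- `R` has a left `B`-basis adapted to the coradical filtration. -/
lemma exists_left_basis (hH : Function.Bijective (HopfAlgebra.antipode k : H →ₗ[k] H))
    (hR : IsConnected k R) :
    ∃ (ι : Type v) (b : Module.Basis ι B.alg R) (deg : ι → ℕ),
      (∀ i, b i ∈ F k H R (deg i + 1)) ∧
        ∀ n, ∀ x ∈ F k H R n, x ∈ Submodule.span B.alg (b '' {i | deg i < n}) := by
  let E := LinearEquiv.ofBijective _ hH
  let S : H →ₗ[k] H := E.symm.toLinearMap
  have hS : ∀ h, HopfAlgebra.antipode k (S h) = h := E.apply_symm_apply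
  have hS' : ∀ h, S (HopfAlgebra.antipode k h) = h := E.symm_apply_apply
  let u : B.alg →ₗ[k] R := B.alg.val.toLinearMap
  have hu : Function.Injective u := Subtype.val_injective
  refine exists_filtered_basis (F k H R) F_zero F_mono (exists_mem_F hR)
    (fun m => (F k H R m).comap u) ?_ (fun m n h => Submodule.comap_mono (F_mono h))
    (fun a => exists_mem_F (H := H) hR (u a)) fun n m z hz hsum φ hφ => ?_
  · rw [F_zero]
    exact LinearMap.ker_eq_bot.2 hu
  · have h1 := tens_induction ((comul (R := k)) ∘ₗ
      (TensorProduct.lift (Algebra.lsmul k k R : B.alg →ₐ[k] Module.End k R).toLinearMap) -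
      braiding k H R R ∘ₗ u.rTensor R) (tens (B.leftSpan n) ⊤ ⊔ tens ⊤ (F k H R m))
      (fun a ha x hx => B.comul_mul_sub_braiding_mem hx a.2 ha) hz
    have h2 : braiding k H R R (u.rTensor R z) ∈
        tens (B.leftSpan n) ⊤ ⊔ tens ⊤ (F k H R m) := by
      have := Submodule.sub_mem _
        (Submodule.mem_sup_left (T := tens ⊤ (F k H R m)) (B.comul_mem_leftSpan hsum)) h1
      rwa [LinearMap.sub_apply, LinearMap.comp_apply, sub_sub_cancel] at this
    -- the inverse braiding interchanges the two factors of the error terms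
    have h3 : tens (B.leftSpan n) ⊤ ⊔ tens ⊤ (F k H R m) ≤
        ((F k H R m).comap (rslice φ)).comap (invBraiding S) := by
      refine sup_le (fun y hy => ?_) fun y hy => ?_
      · have := invBraiding_mem S (fun h v hv => B.smul_mem_leftSpan h hv)
          (fun v hv => coact_mem_top hv) hy
        refine tens_induction (rslice φ) (F k H R m) (fun v _ w hw => ?_) this
        rw [rslice_tmul, hφ w hw, zero_smul]
        exact Submodule.zero_mem _
      · exact mem_tens_top_right.1 (invBraiding_mem S (fun _ _ _ => Submodule.mem_top)
          (isYDSubmodule_iff.1 (isYDSubmodule_F m)).2 hy) φ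
    have h4 := h3 h2
    rwa [Submodule.mem_comap, Submodule.mem_comap, invBraiding_braiding hS hS',
      rslice_rTensor] at h4

/-- The element of `B` given by an element of the opposite algebra. -/
def unopAlg : B.alg.op →ₗ[k] B.alg :=
  LinearMap.codRestrict (Subalgebra.toSubmodule B.alg)
    ((MulOpposite.opLinearEquiv k).symm.toLinearMap ∘ₗ B.alg.op.val.toLinearMap) fun a => a.2

/-- For `T = R / R B⁺` the coinvariants are `B`. If the coordinates of a coinvariant `r` in an
adapted basis have top degree `n ≥ 1`, then at a basis element of this degree the coordinate
functional, composed with the counit, vanishes on `R B⁺` and on `F n`, and slicing `Δ(r)` with it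
yields on the one hand the coordinate of `r`, on the other hand `0`. -/
lemma leftCoinvariants_quotientCoalgebra (hR : IsConnected k R) :
    B.quotientCoalgebra.leftCoinvariants = Subalgebra.toSubmodule B.alg := by
  classical
  refine le_antisymm (fun r hr => ?_) B.le_leftCoinvariants
  obtain ⟨ι, b, deg, hbF, hspan⟩ := B.exists_right_basis hR
  have hsum : ∑ j ∈ (b.repr r).support, b j * (B.unopAlg (b.repr r j) : R) = r :=
    b.linearCombination_repr r
  -- it suffices that all coordinates have degree zero
  suffices hdeg : ∀ j ∈ (b.repr r).support, deg j = 0 by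
    rw [← hsum]
    refine Submodule.sum_mem _ fun j hj => ?_
    have h1 := hbF j
    rw [hdeg j hj, zero_add, F_one] at h1
    obtain ⟨c, hc⟩ := Submodule.mem_span_singleton.1 h1
    rw [← hc, smul_mul_assoc, one_mul]
    exact Submodule.smul_mem _ _ (B.unopAlg _).2
  by_contra! hcon
  obtain ⟨j₀, hj₀, hj₀d⟩ := hcon
  obtain ⟨i, hi, himax⟩ := Finset.exists_max_image _ deg ⟨j₀, hj₀⟩
  have hideg : 1 ≤ deg i := le_trans (Nat.one_le_iff_ne_zero.2 hj₀d) (himax j₀ hj₀)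
  let φ : R →ₗ[k] k := counit (R := k) ∘ₗ B.alg.val.toLinearMap ∘ₗ B.unopAlg ∘ₗ
    (b.coord i).restrictScalars k
  have hφ : ∀ x, φ x = counit (R := k) (B.unopAlg (b.repr x i) : R) := fun _ => rfl
  have hφF : ∀ n ≤ deg i, ∀ x ∈ F k H R n, φ x = 0 := by
    intro n hn x hx
    have h0 : b.repr x i = 0 := by
      have h1 := b.mem_span_image.1 (hspan n x hx)
      by_contra h2
      have h3 : deg i < n := h1 (Finsupp.mem_support_iff.2 h2)
      omega
    rw [hφ, h0, map_zero, ZeroMemClass.coe_zero, map_zero]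
  have hφJ : ∀ x ∈ B.leftIdealK, φ x = 0 := by
    intro x hx
    have h : ∀ a : R, φ (a * x) = 0 := by
      refine Submodule.span_induction ?_ ?_ ?_ ?_ (hx : x ∈ B.leftIdeal)
      · rintro y ⟨hy, hε⟩ a
        have h1 : b.repr (a * y) i = ⟨MulOpposite.op y, hy⟩ * b.repr a i := by
          have : a * y = (⟨MulOpposite.op y, hy⟩ : B.alg.op) • a := rfl
          rw [this, map_smul, Finsupp.smul_apply, smul_eq_mul]
        have h2 : (B.unopAlg (b.repr (a * y) i) : R) = (B.unopAlg (b.repr a i) : R) * y := by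
          rw [h1]; rfl
        rw [hφ, h2, YDHopfAlgebra.counit_mul (H := H), hε, mul_zero]
      · intro a; rw [mul_zero, map_zero]
      · intro x y _ _ hx hy a; rw [mul_add, map_add, hx, hy, add_zero]
      · intro c x _ hx a; rw [smul_eq_mul, ← mul_assoc]; exact hx _
    simpa using h 1
  have hφ0 : ∀ {n : ℕ}, n ≤ deg i → tens (F k H R n) ⊤ ⊔ tens B.leftIdealK ⊤ ≤
      LinearMap.ker (lslice (N := R) φ) := by
    refine fun hn => sup_le (fun z hz => ?_) fun z hz => ?_
    · refine tens_induction (lslice φ) ⊥ (fun u hu v _ => ?_) hz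
      rw [lslice_tmul, hφF _ hn u hu, zero_smul]
      exact Submodule.zero_mem _
    · refine tens_induction (lslice φ) ⊥ (fun u hu v _ => ?_) hz
      rw [lslice_tmul, hφJ u hu, zero_smul]
      exact Submodule.zero_mem _
  have hterm : ∀ j ∈ (b.repr r).support, ∀ c : B.alg,
      lslice φ (comul (R := k) (b j * (c : R))) = φ (b j) • (c : R) := by
    intro j hj c
    have := hφ0 (himax j hj)
      (B.quotientCoalgebra.comul_mul_sub_tmul_mem (B.le_leftCoinvariants c.2) (hbF j))
    rwa [LinearMap.mem_ker, map_sub, lslice_tmul, sub_eq_zero] at this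
  have h1 : lslice φ (comul (R := k) r) = (B.unopAlg (b.repr r i) : R) := by
    conv_lhs => rw [← hsum]
    rw [map_sum, map_sum, Finset.sum_eq_single_of_mem i hi]
    · have : (B.unopAlg 1 : R) = 1 := rfl
      rw [hterm i hi, hφ, b.repr_self, Finsupp.single_eq_same, this, counit_one' k H, one_smul]
    · intro j hj hji
      rw [hterm j hj, hφ, b.repr_self, Finsupp.single_eq_of_ne hji.symm, map_zero,
        ZeroMemClass.coe_zero, map_zero, zero_smul]
  have h2 : lslice φ (comul (R := k) r) = 0 := by
    have h3 := hφ0 hideg (Submodule.mem_sup_right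
      (B.quotientCoalgebra.mem_leftCoinvariants.1 hr))
    have h4 : φ 1 = 0 := hφF 1 hideg 1 (by rw [F_one]; exact Submodule.mem_span_singleton_self _)
    rw [LinearMap.mem_ker] at h3
    rw [comul_eq_deltaL, map_add, h3, lslice_tmul, h4, zero_smul, add_zero]
  rw [h1] at h2
  exact Finsupp.mem_support_iff.1 hi (Subtype.ext (MulOpposite.unop_injective h2))

/-- The inclusion of `B` into `R` splits as a map of right `B`-modules. -/
lemma exists_retraction (hR : IsConnected k R) : ∃ q : R →ₗ[k] B.alg,
    (∀ b : B.alg, q b = b) ∧ ∀ (r : R) (b : B.alg), q (r * b) = q r * b := by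
  obtain ⟨ι, b, deg, hbF, hspan⟩ := B.exists_right_basis hR
  have h1F : (1 : R) ∈ F k H R 1 := by rw [F_one]; exact Submodule.mem_span_singleton_self _
  have h1ne : (1 : R) ≠ 0 := fun h => by
    have := counit_one' k H (R := R)
    rw [h, map_zero] at this
    exact zero_ne_one this
  -- a basis element of degree zero is a multiple of `1`
  have hex : ∃ i, deg i = 0 := by
    by_contra! hcon
    have h2 := hspan 1 1 h1F
    have h3 : {i | deg i < 1} = ∅ := Set.eq_empty_of_forall_notMem fun i hi =>
      hcon i (Nat.lt_one_iff.1 hi)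
    rw [h3, Set.image_empty, Submodule.span_empty, Submodule.mem_bot] at h2
    exact h1ne h2
  obtain ⟨i, hi⟩ := hex
  have hbi := hbF i
  rw [hi, zero_add, F_one] at hbi
  obtain ⟨α, hα⟩ := Submodule.mem_span_singleton.1 hbi
  let q : R →ₗ[k] B.alg := α • B.unopAlg ∘ₗ (b.coord i).restrictScalars k
  have hq : ∀ x, q x = α • B.unopAlg (b.repr x i) := fun _ => rfl
  have hmul : ∀ (r : R) (c : B.alg), q (r * c) = q r * c := by
    intro r c
    have h1 : r * (c : R) = (⟨MulOpposite.op (c : R), c.2⟩ : B.alg.op) • r := rfl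
    have h2 : B.unopAlg (⟨MulOpposite.op (c : R), c.2⟩ * b.repr r i) =
      B.unopAlg (b.repr r i) * c := rfl
    rw [hq, h1, map_smul, Finsupp.smul_apply, smul_eq_mul, h2, hq, smul_mul_assoc]
  have hq1 : q 1 = 1 := by
    have h1 : q (b i) = α • 1 := by
      rw [hq, b.repr_self, Finsupp.single_eq_same]
      rfl
    have hα0 : α ≠ 0 := by
      rintro rfl
      rw [zero_smul] at hα
      have : Nontrivial B.alg.op := ⟨0, 1, fun h =>
        h1ne (congrArg (fun x : B.alg.op => x.1.unop) h).symm⟩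
      exact b.ne_zero i hα.symm
    rw [← hα, map_smul] at h1
    exact smul_right_injective _ hα0 h1
  refine ⟨q, fun c => ?_, hmul⟩
  have := hmul 1 c
  rwa [one_mul, hq1, one_mul] at this

end RightCoidealSubalgebra

end Freeness

/-! ### The correspondence and the normal basis isomorphism -/

section Bijection

open Coalgebra

variable {k H R : Type*} [Field k] [Ring H] [HopfAlgebra k H]
  [Ring R] [Algebra k R] [Coalgebra k R] [Module H R] [IsScalarTower k H R]
  [YetterDrinfeldModule k H R]

lemma RightCoidealSubalgebra.eq_of_alg_eq {B C : RightCoidealSubalgebra k H R}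
    (h : B.alg = C.alg) : B = C := by
  cases B; cases C; cases h; rfl

lemma QuotientLeftModuleCoalgebra.eq_of_ker_eq {T U : QuotientLeftModuleCoalgebra k H R}
    (h : T.ker = U.ker) : T = U := by
  cases T; cases U; cases h; rfl

variable [YDHopfAlgebra k H R]

lemma RightCoidealSubalgebra.leftMap_quotientCoalgebra_bijective
    (B : RightCoidealSubalgebra k H R) (hR : IsConnected k R) (q : R →ₗ[k] B.alg)
    (hq : ∀ b : B.alg, q b = b) : Function.Bijective (B.quotientCoalgebra.leftMap q) := by
  refine B.quotientCoalgebra.leftMap_bijective hR q Subtype.val (fun r => ?_) hq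
  rw [B.leftCoinvariants_quotientCoalgebra hR]
  exact ⟨fun h => ⟨⟨r, h⟩, rfl⟩, fun ⟨v, hv⟩ => hv ▸ v.2⟩

/-- The kernel of `R → T` is `R B⁺` for the algebra `B` of coinvariants: both `R → T ⊗ B` and
`R → (R / R B⁺) ⊗ B` are bijective. -/
lemma QuotientLeftModuleCoalgebra.leftIdeal_coinvariantSubalgebra
    (T : QuotientLeftModuleCoalgebra k H R) (hR : IsConnected k R) :
    T.coinvariantSubalgebra.leftIdeal = T.ker := by
  set B := T.coinvariantSubalgebra with hB
  have hle : B.leftIdeal ≤ T.ker := by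
    refine Submodule.span_le.2 ?_
    rintro b ⟨hb, hε⟩
    have h1 := mem_tens_top_right.1 (T.mem_leftCoinvariants.1 hb) (counit (R := k))
    rwa [deltaL, LinearMap.sub_apply, map_sub, rslice_counit_comul, TensorProduct.mk_apply,
      rslice_tmul, hε, zero_smul, sub_zero] at h1
  refine le_antisymm hle fun x hx => ?_
  obtain ⟨q, hq, -⟩ := B.exists_retraction hR
  let f : B.quotientCoalgebra.Quot →ₗ[k] T.Quot := Submodule.mapQ _ _ LinearMap.id hle
  have hf : f.rTensor B.alg ∘ₗ B.quotientCoalgebra.leftMap q = T.leftMap q := by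
    ext r
    rw [LinearMap.comp_apply, leftMap_apply, leftMap_apply]
    generalize comul (R := k) r = z
    induction z with
    | zero => simp
    | tmul a b => rfl
    | add x y hx hy => simp only [map_add, hx, hy]
  have hbij' := B.leftMap_quotientCoalgebra_bijective hR q hq
  have hbij : Function.Injective (T.leftMap q) := (T.leftMap_bijective hR q Subtype.val
    (fun r => ⟨fun h => ⟨⟨r, h⟩, rfl⟩, fun ⟨v, hv⟩ => hv ▸ v.2⟩) hq).1
  obtain ⟨r, hr⟩ := hbij'.2 (B.quotientCoalgebra.proj x ⊗ₜ[k] (1 : B.alg))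
  have hr0 : r = 0 := by
    refine hbij ?_
    have h1 : f (B.quotientCoalgebra.proj x) = 0 := T.proj_eq_zero_iff.2 hx
    rw [← hf, LinearMap.comp_apply, hr, LinearMap.rTensor_tmul, h1, TensorProduct.zero_tmul,
      map_zero]
  rw [hr0, map_zero] at hr
  have h2 := congrArg (rslice (counit (R := k) ∘ₗ B.alg.val.toLinearMap)) hr
  have h3 : (counit (R := k) ∘ₗ B.alg.val.toLinearMap) 1 = 1 := counit_one' k H
  rw [map_zero, rslice_tmul, h3, one_smul] at h2
  exact B.quotientCoalgebra.proj_eq_zero_iff.1 h2.symm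

/-- The mutually inverse bijections `B ↦ R / R B⁺` and `T ↦ ᶜᵒᵀR`. -/
def correspondence (hR : IsConnected k R) :
    RightCoidealSubalgebra k H R ≃ QuotientLeftModuleCoalgebra k H R where
  toFun B := B.quotientCoalgebra
  invFun T := T.coinvariantSubalgebra
  left_inv B := RightCoidealSubalgebra.eq_of_alg_eq <| Subalgebra.toSubmodule_injective <|
    B.leftCoinvariants_quotientCoalgebra hR
  right_inv T := QuotientLeftModuleCoalgebra.eq_of_ker_eq (T.leftIdeal_coinvariantSubalgebra hR)

/-- The normal basis isomorphism `T ⊗ B → R` for `T = R / R B⁺`. It is the inverse of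
`r ↦ π(r₁) ⊗ q(r₂)`, where `q : R → B` is a right `B`-linear retraction. -/
lemma RightCoidealSubalgebra.exists_normal_basis (B : RightCoidealSubalgebra k H R)
    (hR : IsConnected k R) :
    ∃ e : B.quotientCoalgebra.Quot ⊗[k] B.alg ≃ₗ[k] R,
      (∀ (t : B.quotientCoalgebra.Quot) (b b' : B.alg),
        e (t ⊗ₜ[k] (b * b')) = e (t ⊗ₜ[k] b) * (b' : R)) ∧
      B.quotientCoalgebra.leftCoact ∘ₗ e.toLinearMap =
        e.toLinearMap.lTensor B.quotientCoalgebra.Quot ∘ₗ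
          (TensorProduct.assoc k B.quotientCoalgebra.Quot B.quotientCoalgebra.Quot
            B.alg).toLinearMap ∘ₗ
          (Coalgebra.comul (R := k) (A := B.quotientCoalgebra.Quot)).rTensor B.alg := by
  obtain ⟨q, hq, hqm⟩ := B.exists_retraction hR
  set T := B.quotientCoalgebra
  let E := LinearEquiv.ofBijective (T.leftMap q) (B.leftMap_quotientCoalgebra_bijective hR q hq)
  have hmul : ∀ (r : R) (b : B.alg),
      E (r * b) = (LinearMap.mulRight k b).lTensor T.Quot (E r) := by
    intro r b
    have h1 := T.comul_mul_sub_mem (B.le_leftCoinvariants b.2) r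
    have h2 := tens_induction (TensorProduct.map T.proj q) ⊥ (fun u hu v _ => by
      rw [TensorProduct.map_tmul, T.proj_eq_zero_iff.2 hu, TensorProduct.zero_tmul]
      exact Submodule.zero_mem _) h1
    rw [Submodule.mem_bot, map_sub, sub_eq_zero, ← T.leftMap_apply] at h2
    change T.leftMap q (r * b) = (LinearMap.mulRight k b).lTensor T.Quot (T.leftMap q r)
    rw [h2, T.leftMap_apply]
    generalize comul (R := k) r = z
    induction z with
    | zero => simp
    | tmul a c => simp [hqm]
    | add x y hx hy => simp only [map_add, hx, hy]
  refine ⟨E.symm, fun t b b' => ?_, ?_⟩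
  · rw [LinearEquiv.symm_apply_eq, hmul, LinearEquiv.apply_symm_apply, LinearMap.lTensor_tmul,
      LinearMap.mulRight_apply]
  · have hcol := T.lTensor_leftMap_comp_leftCoact q
    refine LinearMap.ext fun z => ?_
    obtain ⟨r, rfl⟩ := E.surjective z
    have h1 := LinearMap.congr_fun hcol r
    have h2 : E.symm.toLinearMap ∘ₗ T.leftMap q = LinearMap.id :=
      LinearMap.ext fun r => E.symm_apply_apply r
    have h3 := congrArg (E.symm.toLinearMap.lTensor T.Quot) h1
    rw [LinearMap.comp_apply, ← LinearMap.comp_apply, ← LinearMap.lTensor_comp, h2,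
      LinearMap.lTensor_id, LinearMap.id_apply] at h3
    change T.leftCoact (E.symm (E r)) = _
    rw [E.symm_apply_apply]
    exact h3

end Bijection

end BraidedHopf

end

theorem mainTheorem4 {k H R : Type*} [Field k]
    [Ring H] [HopfAlgebra k H]
    (hH : Function.Bijective (HopfAlgebra.antipode k : H →ₗ[k] H))
    [Ring R] [Algebra k R] [Coalgebra k R] [Module H R] [IsScalarTower k H R]
    [BraidedHopf.YetterDrinfeldModule k H R] [BraidedHopf.YDHopfAlgebra k H R]
    (hR : BraidedHopf.IsConnected k R) :
    -- (a) left and right freeness over right coideal subalgebras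
    (∀ B : BraidedHopf.RightCoidealSubalgebra k H R,
      Module.Free B.alg R ∧ Module.Free B.alg.op R) ∧
    -- (b) left and right cofreeness over quotient left module coalgebras
    (∀ T : BraidedHopf.QuotientLeftModuleCoalgebra k H R,
      BraidedHopf.IsLeftCofree T.leftCoact ∧ BraidedHopf.IsRightCofree T.rightCoact) ∧
    -- (c) the mutually inverse bijections `B ↦ R / R B⁺` and `T ↦ ᶜᵒᵀR`
    ∃ Φ : BraidedHopf.RightCoidealSubalgebra k H R ≃
        BraidedHopf.QuotientLeftModuleCoalgebra k H R,
      (∀ B, (Φ B).ker = B.leftIdeal) ∧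
      (∀ T, Subalgebra.toSubmodule (Φ.symm T).alg = T.leftCoinvariants) ∧
      -- (d) for corresponding `B` and `T`, an isomorphism `T ⊗ B ≃ R`, right `B`-linear and
      -- left `T`-colinear
      ∀ (B : BraidedHopf.RightCoidealSubalgebra k H R)
        (T : BraidedHopf.QuotientLeftModuleCoalgebra k H R), Φ B = T →
        ∃ e : T.Quot ⊗[k] B.alg ≃ₗ[k] R,
          (∀ (t : T.Quot) (b b' : B.alg), e (t ⊗ₜ[k] (b * b')) = e (t ⊗ₜ[k] b) * (b' : R)) ∧
          T.leftCoact ∘ₗ e.toLinearMap =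
            e.toLinearMap.lTensor T.Quot ∘ₗ
              (TensorProduct.assoc k T.Quot T.Quot B.alg).toLinearMap ∘ₗ
              (Coalgebra.comul (R := k) (A := T.Quot)).rTensor B.alg := by
  refine ⟨fun B => ⟨?_, ?_⟩, fun T => ⟨T.isLeftCofree_leftCoact hR,
    T.isRightCofree_rightCoact hH hR⟩, BraidedHopf.correspondence hR, fun B => rfl, fun T => rfl,
    ?_⟩
  · obtain ⟨_, b, -⟩ := B.exists_left_basis hH hR
    exact Module.Free.of_basis b
  · obtain ⟨_, b, -⟩ := B.exists_right_basis hR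
    exact Module.Free.of_basis b
  · rintro B _ rfl
    exact B.exists_normal_basis hR
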